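/- Let $(R,\mathfrak m,k)$ be a commutative Noetherian local ring. For a complex $X$ of $R$-modules write $H^i(X)=H_{-i}(X)$. Let $Y$ be a homologically bounded complex of $R$-modules with finitely generated homology modules that is not homologically trivial. Put $$\operatorname{id}_R Y=\inf\bigl\{\sup\{i\in\mathbb Z: I^i\neq 0\} : I \text{ an injective resolution of } Y\bigr\},\qquad \operatorname{depth}_R Y=-\sup \mathbf R\mathrm{Hom}_R(k,Y)=\inf\{i\in\mathbb Z:\operatorname{Ext}^i_R(k,Y)\neq 0\},$$ with values in $\mathbb Z\cup\{\pm\infty\}$, where an injective resolution of $Y$ is a complex of injective modules with $I^i=0$ for $i\ll 0$ that is isomorphic to $Y$ in the derived category. Call $Y$ Gorenstein if $\operatorname{id}_R Y=\operatorname{depth}_R Y$. For a complex $X$ with $H^i(X)=0$ for $i\gg 0$ put $H^i_{\mathfrak m}(X,Y)=H^i\bigl(\mathbf R\Gamma_{\mathfrak m}(\mathbf R\mathrm{Hom}_R(X,Y))\bigr)$, where $\Gamma_{\mathfrak m}(M)=\varinjlim_n \mathrm{Hom}_R(R/\mathfrak m^n,M)$ is the $\mathfrak m$-torsion functor. Let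 $\mathcal D_0^f(R)$ be the class of complexes of $R$-modules whose homology is finitely generated and concentrated in degree $0$, and let $$Y^{\perp}=\{X\in\mathcal D_0^f(R) : H^i_{\mathfrak m}(X,Y)=0 \text{ for all } i\neq\operatorname{depth}_R Y\}.$$ The following are equivalent: 1. $Y$ is Gorenstein; 2. $Y^{\perp}=\mathcal D_0^f(R)$; 3. $k\in Y^{\perp}$, where $k$ is regarded as a complex concentrated in degree $0$. -/

import Mathlib

open CategoryTheory

namespace GorCx

universe u

variable {R : Type u} [CommRing R]

/-!
Objects of the derived category `D(R)` are complexes of `R`-modules. They are written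
cohomologically, as cochain complexes indexed by `ℤ`: the homology module `H_ℓ(X)` of the
homological notation is `X.homology (-ℓ)`.
-/

/-- `X` is homologically bounded to the left: `H_ℓ(X) = 0` for `ℓ ≫ 0`, that is `H^i(X) = 0` for
`i ≪ 0`. -/
def BddLeft (X : CochainComplex (ModuleCat.{u} R) ℤ) : Prop :=
  ∃ n : ℤ, ∀ i < n, Limits.IsZero (X.homology i)

/-- `X` is homologically bounded to the right: `H_ℓ(X) = 0` for `ℓ ≪ 0`, that is `H^i(X) = 0` for
`i ≫ 0`. -/
def BddRight (X : CochainComplex (ModuleCat.{u} R) ℤ) : Prop :=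
  ∃ n : ℤ, ∀ i > n, Limits.IsZero (X.homology i)

/-- All homology modules of `X` are finitely generated. -/
def HomologyFG (X : CochainComplex (ModuleCat.{u} R) ℤ) : Prop :=
  ∀ i : ℤ, Module.Finite R (X.homology i)

/-- Homologically bounded complexes with finitely generated homology modules. -/
structure BddFG (X : CochainComplex (ModuleCat.{u} R) ℤ) : Prop where
  left : BddLeft X
  right : BddRight X
  fg : HomologyFG X

/-- Complexes with finitely generated homology concentrated in degree `0`. -/
structure DegZeroFG (X : CochainComplex (ModuleCat.{u} R) ℤ) : Prop where
  conc : ∀ i : ℤ, i ≠ 0 → Limits.IsZero (X.homology i)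
  fg : HomologyFG X

theorem DegZeroFG.right {X : CochainComplex (ModuleCat.{u} R) ℤ} (h : DegZeroFG X) :
    BddRight X :=
  ⟨0, fun i hi => h.conc i (ne_of_gt hi)⟩

/-- `X` is homologically trivial: all its homology vanishes. -/
def HomologicallyTrivial (X : CochainComplex (ModuleCat.{u} R) ℤ) : Prop :=
  ∀ i : ℤ, Limits.IsZero (X.homology i)

/-- A module, viewed as a complex concentrated in degree `0`. -/
noncomputable abbrev ofModule (M : ModuleCat.{u} R) : CochainComplex (ModuleCat.{u} R) ℤ :=
  (CochainComplex.singleFunctor (ModuleCat.{u} R) 0).obj M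

/-! ### Injective resolutions and injective dimension -/

/-- `I` is an injective resolution of `X`: a complex of injective modules, vanishing in all
sufficiently small cohomological degrees, with a quasi-isomorphism `X ⟶ I`. (As such an `I` is
K-injective, this is the same as an isomorphism between `X` and `I` in the derived category.) -/
structure IsInjRes (X I : CochainComplex (ModuleCat.{u} R) ℤ) : Prop where
  injective : ∀ i : ℤ, Injective (I.X i)
  bounded : ∃ n : ℤ, ∀ i < n, Limits.IsZero (I.X i)
  quasiIso : ∃ f : X ⟶ I, QuasiIso f

theorem BddLeft.exists_isGE {X : CochainComplex (ModuleCat.{u} R) ℤ} (h : BddLeft X) :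
    ∃ n : ℤ, X.IsGE n := by
  obtain ⟨n, hn⟩ := h
  refine ⟨n, (X.isGE_iff n).2 fun i hi => ?_⟩
  rw [HomologicalComplex.exactAt_iff_isZero_homology]
  exact hn i hi

theorem BddRight.exists_isLE {X : CochainComplex (ModuleCat.{u} R) ℤ} (h : BddRight X) :
    ∃ n : ℤ, X.IsLE n := by
  obtain ⟨n, hn⟩ := h
  refine ⟨n, (X.isLE_iff n).2 fun i hi => ?_⟩
  rw [HomologicalComplex.exactAt_iff_isZero_homology]
  exact hn i hi

theorem exists_isInjRes {X : CochainComplex (ModuleCat.{u} R) ℤ} (h : BddLeft X) :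
    ∃ I, IsInjRes X I := by
  obtain ⟨n, _⟩ := h.exists_isGE
  obtain ⟨I, i, _, hI, hI'⟩ :=
    CochainComplex.Plus.modelCategoryQuillen.exists_quasiIso_injective (X.truncGE n) n
  exact ⟨I, hI, ⟨n, fun j hj => I.isZero_of_isStrictlyGE n j hj⟩,
    ⟨X.πTruncGE n ≫ i, inferInstance⟩⟩

/-- A chosen injective resolution of a complex homologically bounded to the left. -/
noncomputable def injRes (X : CochainComplex (ModuleCat.{u} R) ℤ) (h : BddLeft X) :
    CochainComplex (ModuleCat.{u} R) ℤ :=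
  (exists_isInjRes h).choose

theorem injRes_spec (X : CochainComplex (ModuleCat.{u} R) ℤ) (h : BddLeft X) :
    IsInjRes X (injRes X h) :=
  (exists_isInjRes h).choose_spec

/-- The injective dimension
`inf { sup { i | I^i ≠ 0 } | I an injective resolution of Y }`, in `ℤ ∪ {±∞}`. -/
noncomputable def injDim (Y : CochainComplex (ModuleCat.{u} R) ℤ) : EInt :=
  sInf {s : EInt | ∃ I, IsInjRes Y I ∧
    s = sSup {t : EInt | ∃ i : ℤ, ¬ Limits.IsZero (I.X i) ∧ t = i}}

/-! ### The right derived homomorphism functor, Ext and depth -/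

/-- The complex of `R`-modules `Hom_R(X, Y)`, with `Hom_R(X, Y)^n = ∏_p Hom_R(X^p, Y^{p+n})`. -/
noncomputable def homComplex (X Y : CochainComplex (ModuleCat.{u} R) ℤ) :
    CochainComplex (ModuleCat.{u} R) ℤ where
  X n := ModuleCat.of R (CochainComplex.HomComplex.Cochain X Y n)
  d n m := ModuleCat.ofHom (CochainComplex.HomComplex.δ_hom R X Y n m)
  shape n m h := by
    ext z : 2
    exact CochainComplex.HomComplex.δ_shape n m h z
  d_comp_d' n m p _ _ := by
    ext z : 2
    exact CochainComplex.HomComplex.δ_δ n m p z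

/-- `RHom_R(X, Y)`, for `Y` homologically bounded to the left: `Hom_R(X, I)`, with `I` an injective
resolution of `Y`. -/
noncomputable def rHom (X Y : CochainComplex (ModuleCat.{u} R) ℤ) (hY : BddLeft Y) :
    CochainComplex (ModuleCat.{u} R) ℤ :=
  homComplex X (injRes Y hY)

/-- `Ext^i_R(X, Y) = H^i(RHom_R(X, Y))`. -/
noncomputable def ext (X Y : CochainComplex (ModuleCat.{u} R) ℤ) (hY : BddLeft Y) (i : ℤ) :
    ModuleCat.{u} R :=
  (rHom X Y hY).homology i

/-- `depth(a, Y) = - sup RHom_R(R/a, Y)`, that is `inf { i | Ext^i_R(R/a, Y) ≠ 0 }`,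
in `ℤ ∪ {±∞}`. -/
noncomputable def depth (a : Ideal R) (Y : CochainComplex (ModuleCat.{u} R) ℤ) (hY : BddLeft Y) :
    EInt :=
  sInf {t : EInt | ∃ i : ℤ, ¬ Limits.IsZero (ext (ofModule (ModuleCat.of R (R ⧸ a))) Y hY i) ∧
    t = i}

attribute [local instance] HasDerivedCategory.standard in
theorem rHom_bddLeft {X Y : CochainComplex (ModuleCat.{u} R) ℤ} (hX : BddRight X)
    (hY : BddLeft Y) : BddLeft (rHom X Y hY) := by
  obtain ⟨b, hb⟩ := hX.exists_isLE
  obtain ⟨hI, ⟨a, ha⟩, -⟩ := injRes_spec Y hY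
  unfold rHom
  generalize injRes Y hY = I at hI ha
  have hIa : I.IsStrictlyGE a := (I.isStrictlyGE_iff a).2 fun i hi => ha i hi
  have : I.IsKInjective := CochainComplex.isKInjective_of_injective I a
  refine ⟨a - b, fun n hn => ?_⟩
  rw [← HomologicalComplex.exactAt_iff_isZero_homology,
    HomologicalComplex.exactAt_iff' _ (n - 1) n (n + 1) (by simp) (by simp),
    ShortComplex.moduleCat_exact_iff]
  intro (z : CochainComplex.HomComplex.Cochain X I n)
    (hz : CochainComplex.HomComplex.δ n (n + 1) z = 0)
  let c : CochainComplex.HomComplex.Cocycle X I n :=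
    CochainComplex.HomComplex.Cocycle.mk z (n + 1) rfl hz
  have hc : c ∈ CochainComplex.HomComplex.coboundaries X I n := by
    rw [← CochainComplex.HomComplex.CohomologyClass.toHom_mk_eq_zero_iff]
    apply (CochainComplex.IsKInjective.Qh_map_bijective _ (I⟦n⟧)).injective
    rw [Functor.map_zero]
    have h1 : (DerivedCategory.Q.obj X).IsLE b := inferInstance
    have h2 : (I⟦n⟧).IsStrictlyGE (a - n) := I.isStrictlyGE_shift a n (a - n) (by lia)
    have h3 : (DerivedCategory.Q.obj (I⟦n⟧)).IsGE (a - n) := inferInstance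
    exact DerivedCategory.TStructure.t.zero_of_isLE_of_isGE
      (X := DerivedCategory.Q.obj X) (Y := DerivedCategory.Q.obj (I⟦n⟧)) _ b (a - n) (by lia) h1 h3
  obtain ⟨y, hy⟩ :=
    (CochainComplex.HomComplex.mem_coboundaries_iff c (n - 1) (by lia)).1 hc
  exact ⟨y, hy⟩

/-! ### Local cohomology -/

/-- The `a`-torsion submodule `Γ_a(M) = { x | a ^ n x = 0 for some n } = colim_n Hom(R/a^n, M)`. -/
def torsionSubmodule (a : Ideal R) (M : Type u) [AddCommGroup M] [Module R M] :
    Submodule R M where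
  carrier := {x | ∃ n : ℕ, ∀ r ∈ a ^ n, r • x = 0}
  zero_mem' := ⟨0, fun r _ => smul_zero r⟩
  add_mem' := by
    rintro x y ⟨n, hx⟩ ⟨m, hy⟩
    refine ⟨n + m, fun r hr => ?_⟩
    rw [smul_add, hx r (Ideal.pow_le_pow_right (Nat.le_add_right n m) hr),
      hy r (Ideal.pow_le_pow_right (Nat.le_add_left m n) hr), add_zero]
  smul_mem' := by
    rintro c x ⟨n, hx⟩
    exact ⟨n, fun r hr => by rw [smul_comm, hx r hr, smul_zero]⟩

/-- The `a`-section functor `Γ_a`. -/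
noncomputable def sectionFunctor (a : Ideal R) : ModuleCat.{u} R ⥤ ModuleCat.{u} R where
  obj M := ModuleCat.of R (torsionSubmodule a M)
  map {M N} f := ModuleCat.ofHom (f.hom.restrict (p := torsionSubmodule a M)
    (q := torsionSubmodule a N) (by
      rintro x ⟨n, hx⟩
      exact ⟨n, fun r hr => by rw [← map_smul, hx r hr, map_zero]⟩))
  map_id _ := rfl
  map_comp _ _ := rfl

instance (a : Ideal R) : (sectionFunctor a).Additive where
  map_add := rfl

/-- `RΓ_a(X) = Γ_a(I)`, with `I` an injective resolution of `X`. -/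
noncomputable def rGamma (a : Ideal R) (X : CochainComplex (ModuleCat.{u} R) ℤ)
    (hX : BddLeft X) : CochainComplex (ModuleCat.{u} R) ℤ :=
  ((sectionFunctor a).mapHomologicalComplex (ComplexShape.up ℤ)).obj (injRes X hX)

/-- The generalized `a`-section complex `RΓ_a(X, Y) = RΓ_a(RHom_R(X, Y))`. -/
noncomputable def genRGamma (a : Ideal R) (X Y : CochainComplex (ModuleCat.{u} R) ℤ)
    (hX : BddRight X) (hY : BddLeft Y) : CochainComplex (ModuleCat.{u} R) ℤ :=
  rGamma a (rHom X Y hY) (rHom_bddLeft hX hY)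

/-- The generalized local cohomology module `H^i_a(X, Y) = H^i(RΓ_a(X, Y))`. -/
noncomputable def genLocalCohomology (a : Ideal R) (X Y : CochainComplex (ModuleCat.{u} R) ℤ)
    (hX : BddRight X) (hY : BddLeft Y) (i : ℤ) : ModuleCat.{u} R :=
  (genRGamma a X Y hX hY).homology i

/-! ### Local rings -/

section Local

variable [IsLocalRing R]

/-- The depth of a complex over a local ring `(R, 𝔪)`: `depth(𝔪, Y)`. -/
noncomputable def localDepth (Y : CochainComplex (ModuleCat.{u} R) ℤ) (hY : BddLeft Y) : EInt :=
  depth (IsLocalRing.maximalIdeal R) Y hY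

/-- `Y^⊥`: the complexes `X` with finitely generated homology concentrated in degree `0` such
that `H^i_𝔪(X, Y) = 0` for all `i ≠ depth Y`. -/
def perp (Y : CochainComplex (ModuleCat.{u} R) ℤ) (hY : BddLeft Y) :
    Set (CochainComplex (ModuleCat.{u} R) ℤ) :=
  {X | ∃ hX : DegZeroFG X, ∀ i : ℤ, (i : EInt) ≠ localDepth Y hY →
    Limits.IsZero (genLocalCohomology (IsLocalRing.maximalIdeal R) X Y hX.right hY i)}

/-- A Gorenstein complex: a homologically nontrivial, homologically bounded complex with finitely
generated homology whose injective dimension equals its depth. -/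
def IsGorenstein (Y : CochainComplex (ModuleCat.{u} R) ℤ) : Prop :=
  ∃ hY : BddFG Y, ¬ HomologicallyTrivial Y ∧ injDim Y = localDepth Y hY.left

end Local

end GorCx

/-!
Let `I` be an injective resolution of `Y`. For a module `M`, write `Hom_R(M, I)` for the complex with
terms `Hom_R(M, I^n)`; its homology is `Ext^n(M, Y)`, and `H^n_𝔪(M, Y)` is the local cohomology of this
complex.

*Gorenstein complexes and the residue field.* If `Ext^i(k, Y) = 0` for all `i > n`, a dévissage along
cyclic modules (`cyclic_induction`), in which Nakayama's lemma handles the primes different from `𝔪`,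
gives `Ext^i(R ⧸ a, Y) = 0` for all ideals `a` and all `i > n`
(`isZero_homology_homFrom_quotient`). By Baer's criterion the cocycles `Z^n(I)` are then injective, so
that `τ^{≤ n} I` is an injective resolution and `id Y ≤ n` (`injDim_le`). Conversely, `Ext^i(k, Y) = 0`
for `i > id Y`, and for `i < depth Y` by definition of the depth. Hence `Y` is Gorenstein if and only if
`Ext^i(k, Y) = 0` for all `i ≠ depth Y` (`injDim_eq_localDepth_iff`). As `Ext^i(k, Y)` is torsion,
it vanishes exactly when `H^i_𝔪(k, Y)` does: for a bounded below complex `J` of injectives with torsion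
homology, `J ⧸ Γ_𝔪(J)` is a complex of torsion-free injectives with torsion homology, and such a complex
is acyclic (`isZero_homology_sectionComplex_iff`).

*From the residue field to all modules.* The vanishing of `H^i_𝔪(W)` is expressed in the derived
category as `colim_n Hom(R ⧸ 𝔪^n, W[i]) = 0` (`LocalCohomologyVanishes`), a property which passes to the
middle term of a distinguished triangle. For a fixed `i`, it holds for `Hom_R(R ⧸ a, I)` for all ideals
`a` as soon as it holds for `a = 𝔪`: in the dévissage, if `x ∈ 𝔪` lies outside a prime `p` then
vanishing for `R ⧸ (p + (x))` makes `x` injective on `H^i_𝔪(R ⧸ p, Y)`, on which `x` is also locally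
nilpotent (`localCohomologyVanishes_homFrom`). The same degree `i` occurs throughout, so the case of `k`
implies that of every finitely generated module, hence of every complex with finitely generated homology
concentrated in degree `0`, which is quasi-isomorphic to such a module (`exists_iso_Q_homFrom`).
-/

namespace GorCx

universe u

variable {R : Type u} [CommRing R]

/-! ### The torsion submodule of an injective module -/

/-- By the Artin–Rees lemma, a map from an ideal `I` to `Γ_a(M)` kills `a ^ N ⊓ I` for some `N`, so
an extension to `R` with values in `M` may be chosen to factor through `R ⧸ a ^ N`; its image is
then torsion. -/
theorem baer_torsionSubmodule [IsNoetherianRing R] (a : Ideal R) (M : Type u) [AddCommGroup M]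
    [Module R M] (hM : Module.Injective R M) : Module.Baer R (torsionSubmodule a M) := by
  intro I g
  -- a single power of `a` kills the image of the finitely generated ideal `I`
  obtain ⟨n, hn⟩ : ∃ n : ℕ, ∀ r ∈ a ^ n, ∀ y : I, r • g y = 0 := by
    obtain ⟨s, hs⟩ := (IsNoetherian.noetherian (⊤ : Submodule R I))
    choose ν hν using fun y : I => (g y).2
    refine ⟨s.sup ν, fun r hr y => ?_⟩
    have hy : y ∈ Submodule.span R (s : Set I) := hs ▸ Submodule.mem_top
    induction hy using Submodule.span_induction with
    | mem y hy =>
      exact Subtype.ext (hν y r (Ideal.pow_le_pow_right (Finset.le_sup (f := ν) hy) hr))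
    | zero => simp
    | add y z _ _ h1 h2 => rw [map_add, smul_add, h1, h2, add_zero]
    | smul c y _ h => rw [map_smul, smul_comm, h, smul_zero]
  obtain ⟨k, hk⟩ := a.exists_pow_inf_eq_pow_smul (M := R) I
  have hkill : ∀ y : I, (y : R) ∈ a ^ (n + k) → g y = 0 := by
    intro y hy
    have h1 : (y : R) ∈ (a ^ (n + k) • (⊤ : Submodule R R) ⊓ I : Submodule R R) :=
      ⟨by simpa using hy, y.2⟩
    rw [hk _ (Nat.le_add_left k n), Nat.add_sub_cancel] at h1
    have h2 : (y : R) ∈ a ^ n • (I : Submodule R R) := Submodule.smul_mono le_rfl inf_le_right h1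
    have h3 : ∀ x (hx : x ∈ a ^ n • (I : Submodule R R)),
        ∃ hx' : x ∈ I, g ⟨x, hx'⟩ = 0 := by
      intro x hx
      refine Submodule.smul_induction_on hx (fun r hr z hz => ⟨I.smul_mem r hz, ?_⟩) ?_
      · exact (map_smul g r ⟨z, hz⟩).trans (hn r hr ⟨z, hz⟩)
      · rintro x y ⟨hx, hx0⟩ ⟨hy, hy0⟩
        exact ⟨I.add_mem hx hy, (map_add g ⟨x, hx⟩ ⟨y, hy⟩).trans (by rw [hx0, hy0, add_zero])⟩
    exact (h3 _ h2).2
  -- the induced map on the image of `I` in `R ⧸ a ^ (n + k)`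
  let π : I →ₗ[R] R ⧸ a ^ (n + k) := (a ^ (n + k)).mkQ ∘ₗ I.subtype
  have hker : LinearMap.ker π ≤ LinearMap.ker ((torsionSubmodule a M).subtype ∘ₗ g) := by
    intro y hy
    have hy' : (y : R) ∈ a ^ (n + k) := (Submodule.Quotient.mk_eq_zero _).1 hy
    simp [hkill y hy']
  let g₁ : LinearMap.range π →ₗ[R] M :=
    (LinearMap.ker π).liftQ _ hker ∘ₗ π.quotKerEquivRange.symm.toLinearMap
  obtain ⟨h, hh⟩ := hM.out (LinearMap.range π).subtype (Submodule.injective_subtype _) g₁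
  refine ⟨(h ∘ₗ (a ^ (n + k)).mkQ).codRestrict _ fun x => ⟨n + k, fun r hr => ?_⟩, ?_⟩
  · have : r • (a ^ (n + k)).mkQ x = 0 := by
      rw [← map_smul]
      exact (Submodule.Quotient.mk_eq_zero _).2 (Ideal.mul_mem_right _ _ hr)
    rw [LinearMap.comp_apply, ← map_smul, this, map_zero]
  · intro x hx
    refine Subtype.ext ?_
    have h1 := hh ⟨π ⟨x, hx⟩, ⟨_, rfl⟩⟩
    have h2 : π.quotKerEquivRange.symm ⟨π ⟨x, hx⟩, ⟨_, rfl⟩⟩ =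
        (LinearMap.ker π).mkQ ⟨x, hx⟩ := by
      rw [LinearEquiv.symm_apply_eq]
      rfl
    have h3 : g₁ ⟨π ⟨x, hx⟩, ⟨_, rfl⟩⟩ = g ⟨x, hx⟩ := by
      simp only [g₁, LinearMap.comp_apply, LinearEquiv.coe_coe, h2]
      rfl
    exact h1.trans h3

theorem injective_sectionFunctor_obj [IsNoetherianRing R] (a : Ideal R) (M : ModuleCat.{u} R)
    [hM : Injective M] : Injective ((sectionFunctor a).obj M) := by
  have : Module.Injective R M := (Module.injective_iff_injective_object R M).2 hM
  exact (Module.injective_iff_injective_object R (torsionSubmodule a M)).1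
    (baer_torsionSubmodule a M this).injective

/-- The inclusion `Γ_a(M) ⟶ M`. -/
noncomputable def sectionι (a : Ideal R) : sectionFunctor a ⟶ 𝟭 (ModuleCat.{u} R) where
  app M := ModuleCat.ofHom (torsionSubmodule a M).subtype
  naturality _ _ _ := rfl

/-- `M` has no nonzero element killed by a power of `a`. -/
def TorsionFree (a : Ideal R) (M : ModuleCat.{u} R) : Prop :=
  torsionSubmodule a M = ⊥

theorem TorsionFree.of_mono {a : Ideal R} {M N : ModuleCat.{u} R} (f : M ⟶ N) [Mono f]
    (h : TorsionFree a N) : TorsionFree a M := by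
  rw [TorsionFree, eq_bot_iff]
  rintro x ⟨n, hn⟩
  have h1 : f x ∈ torsionSubmodule a N := ⟨n, fun r hr => by rw [← map_smul, hn r hr, map_zero]⟩
  rw [h, Submodule.mem_bot] at h1
  exact (ModuleCat.mono_iff_injective f).1 inferInstance (h1.trans (map_zero f.hom).symm)

/-- Every element of `M` is killed by a power of `a`. -/
def IsTorsionModule (a : Ideal R) (M : ModuleCat.{u} R) : Prop :=
  torsionSubmodule a M = ⊤

theorem IsTorsionModule.of_mono {a : Ideal R} {M N : ModuleCat.{u} R} (f : M ⟶ N) [Mono f]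
    (h : IsTorsionModule a N) : IsTorsionModule a M := by
  rw [IsTorsionModule, eq_top_iff]
  rintro x -
  obtain ⟨n, hn⟩ : f x ∈ torsionSubmodule a N := h ▸ Submodule.mem_top
  refine ⟨n, fun r hr => (ModuleCat.mono_iff_injective f).1 inferInstance ?_⟩
  rw [map_smul, hn r hr, map_zero]

theorem IsTorsionModule.of_epi {a : Ideal R} {M N : ModuleCat.{u} R} (f : M ⟶ N) [Epi f]
    (h : IsTorsionModule a M) : IsTorsionModule a N := by
  rw [IsTorsionModule, eq_top_iff]
  rintro y -
  obtain ⟨x, rfl⟩ := (ModuleCat.epi_iff_surjective f).1 inferInstance y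
  obtain ⟨n, hn⟩ : x ∈ torsionSubmodule a M := h ▸ Submodule.mem_top
  exact ⟨n, fun r hr => by rw [← map_smul, hn r hr, map_zero]⟩

theorem isTorsionModule_sectionFunctor_obj (a : Ideal R) (M : ModuleCat.{u} R) :
    IsTorsionModule a ((sectionFunctor a).obj M) := by
  rw [IsTorsionModule, eq_top_iff]
  rintro ⟨x, n, hn⟩ -
  exact ⟨n, fun r hr => Subtype.ext (hn r hr)⟩

/-- A module `M` in the middle of an exact sequence with `a`-torsion outer terms is `a`-torsion, when
`a` is finitely generated: if `a ^ n` kills the image of `x`, each of finitely many generators of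
`a ^ n` maps `x` to a torsion element. -/
theorem IsTorsionModule.of_exact [IsNoetherianRing R] {a : Ideal R} (S : ShortComplex (ModuleCat.{u} R))
    (hS : S.Exact) (h₁ : IsTorsionModule a S.X₁) (h₃ : IsTorsionModule a S.X₃) :
    IsTorsionModule a S.X₂ := by
  rw [IsTorsionModule, eq_top_iff]
  rintro x -
  obtain ⟨n, hn⟩ : S.g x ∈ torsionSubmodule a S.X₃ := h₃ ▸ Submodule.mem_top
  have h4 : ∀ r ∈ a ^ n, r • x ∈ torsionSubmodule a S.X₂ := by
    intro r hr
    obtain ⟨y, hy⟩ := (ShortComplex.moduleCat_exact_iff S).1 hS (r • x)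
      (by rw [map_smul, hn r hr])
    obtain ⟨m, hm⟩ : y ∈ torsionSubmodule a S.X₁ := h₁ ▸ Submodule.mem_top
    exact ⟨m, fun s hs => by rw [← hy, ← map_smul, hm s hs, map_zero]⟩
  obtain ⟨s, hs⟩ := (IsNoetherian.noetherian (a ^ n : Submodule R R))
  choose! ν hν using h4
  refine ⟨s.sup ν + n, fun r hr => ?_⟩
  rw [pow_add] at hr
  refine Submodule.smul_induction_on hr (fun p hp q hq => ?_) fun p q hp hq => by
    rw [add_smul, hp, hq, add_zero]
  rw [smul_assoc]
  rw [← hs] at hq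
  have hsub : ∀ q ∈ (s : Set R), q ∈ a ^ n := fun q hq => hs ▸ Submodule.subset_span hq
  induction hq using Submodule.span_induction with
  | mem q hq => exact hν q (hsub q hq) p (Ideal.pow_le_pow_right (Finset.le_sup (f := ν) hq) hp)
  | zero => simp
  | add y z _ _ h1 h2 => rw [add_smul, smul_add, h1, h2, add_zero]
  | smul c y _ h => rw [smul_assoc, smul_comm, h, smul_zero]

theorem TorsionFree.eq_zero {a : Ideal R} {M N : ModuleCat.{u} R} (hN : TorsionFree a N)
    (hM : IsTorsionModule a M) (f : M ⟶ N) : f = 0 := by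
  ext x
  obtain ⟨n, hn⟩ : x ∈ torsionSubmodule a M := hM ▸ Submodule.mem_top
  have : f x ∈ torsionSubmodule a N := ⟨n, fun r hr => by rw [← map_smul, hn r hr, map_zero]⟩
  rwa [hN, Submodule.mem_bot] at this

/-! ### Torsion sections of complexes of injectives with torsion homology -/

theorem injective_X₃ {C : Type*} [Category* C] [Abelian C] {S : ShortComplex C}
    (hS : S.ShortExact) [Injective S.X₁] [Injective S.X₂] : Injective S.X₃ where
  factors g f _ :=
    ⟨Injective.factorThru (g ≫ hS.splittingOfInjective.s) f ≫ S.g, by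
      rw [Injective.comp_factorThru_assoc, Category.assoc, hS.splittingOfInjective.s_g,
        Category.comp_id]⟩

theorem TorsionFree.X₃ {a : Ideal R} {S : ShortComplex (ModuleCat.{u} R)}
    (hS : S.ShortExact) [Injective S.X₁] (h : TorsionFree a S.X₂) : TorsionFree a S.X₃ := by
  have : Mono hS.splittingOfInjective.s := ⟨fun u v huv => by
    rw [← Category.comp_id u, ← Category.comp_id v, ← hS.splittingOfInjective.s_g,
      reassoc_of% huv]⟩
  exact h.of_mono hS.splittingOfInjective.s

/-- The cokernel of the split inclusion `Γ_a(M) ⟶ M` of an injective module is torsion-free. -/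
theorem torsionFree_of_section [IsNoetherianRing R] {a : Ideal R} (M : ModuleCat.{u} R)
    [Injective M] {N : ModuleCat.{u} R} (g : M ⟶ N) (w : (sectionι a).app M ≫ g = 0)
    (hS : (ShortComplex.mk _ _ w).ShortExact) : TorsionFree a N := by
  have : Injective (ShortComplex.mk _ _ w).X₁ := injective_sectionFunctor_obj a M
  let s : N ⟶ M := hS.splittingOfInjective.s
  have hs : s ≫ g = 𝟙 N := hS.splittingOfInjective.s_g
  rw [TorsionFree, eq_bot_iff]
  rintro x ⟨n, hn⟩
  have h1 : s x ∈ torsionSubmodule a M := ⟨n, fun r hr => by rw [← map_smul, hn r hr, map_zero]⟩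
  have h2 : g (s x) = x := ConcreteCategory.congr_hom hs x
  have h3 : g (s x) = 0 := ConcreteCategory.congr_hom w ⟨s x, h1⟩
  exact h2.symm.trans h3

/-- Inductively, the opcycles `Q^i ⧸ B^i` of `Q` are injective and torsion-free: the homology in
degree `i` embeds in the torsion-free opcycles, so it vanishes, and the opcycles in degree `i + 1`
are then the cokernel of a split monomorphism into the term of degree `i + 1`. -/
theorem isZero_homology_of_torsionFree {a : Ideal R} (Q : CochainComplex (ModuleCat.{u} R) ℤ)
    (n : ℤ) (hn : ∀ i < n, Limits.IsZero (Q.X i)) (hinj : ∀ i, Injective (Q.X i))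
    (htf : ∀ i, TorsionFree a (Q.X i)) (hH : ∀ i, IsTorsionModule a (Q.homology i)) (i : ℤ) :
    Limits.IsZero (Q.homology i) := by
  have key : ∀ i, TorsionFree a (Q.opcycles i) → Limits.IsZero (Q.homology i) := fun i hi => by
    rw [Limits.IsZero.iff_id_eq_zero, ← cancel_mono (Q.homologyι i)]
    simpa using hi.eq_zero (hH i) (Q.homologyι i)
  have hlow : ∀ i < n, Limits.IsZero (Q.opcycles i) := fun i hi => by
    rw [Limits.IsZero.iff_id_eq_zero, ← cancel_epi (Q.pOpcycles i)]
    exact (hn i hi).eq_of_src _ _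
  rcases lt_or_ge i n with hi | hi
  · exact (hlow i hi).of_mono (Q.homologyι i)
  suffices ∀ i, n - 1 ≤ i → Injective (Q.opcycles i) ∧ TorsionFree a (Q.opcycles i) from
    key i (this i (by lia)).2
  intro i hi
  induction i, hi using Int.leInduction with
  | base =>
    have h0 := hlow (n - 1) (by lia)
    refine ⟨h0.injective, ?_⟩
    rw [TorsionFree, eq_bot_iff]
    intro x _
    have := ModuleCat.subsingleton_of_isZero h0
    exact Subsingleton.elim _ _
  | succ i _ ih =>
    obtain ⟨h1, h2⟩ := ih
    have hz := key i h2
    let S := ShortComplex.mk (Q.fromOpcycles i (i + 1)) (Q.pOpcycles (i + 1)) (by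
      rw [← cancel_epi (Q.pOpcycles i)]; simp)
    have hmono : Mono S.f := by
      let T := ShortComplex.mk (Q.homologyι i) (Q.fromOpcycles i (i + 1)) (by simp)
      have hT : T.Exact := T.exact_of_f_is_kernel (Q.homologyIsKernel i (i + 1) (by simp))
      exact hT.mono_g (hz.eq_of_src _ _)
    have hS : S.ShortExact :=
      { exact := by
          let T := ShortComplex.mk (Q.d i (i + 1)) (Q.pOpcycles (i + 1)) (by simp)
          have hT : T.Exact := T.exact_of_g_is_cokernel (Q.opcyclesIsCokernel i (i + 1) (by simp))
          let π : T ⟶ S := { τ₁ := Q.pOpcycles i, τ₂ := 𝟙 _, τ₃ := 𝟙 _ }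
          exact (ShortComplex.exact_iff_of_epi_of_isIso_of_mono π).1 hT
        mono_f := hmono
        epi_g := inferInstanceAs (Epi (Q.pOpcycles (i + 1))) }
    have : Injective S.X₁ := h1
    have : Injective S.X₂ := hinj (i + 1)
    exact ⟨injective_X₃ hS, TorsionFree.X₃ hS (htf (i + 1))⟩

/-- The complex `Γ_a(J)`. -/
noncomputable abbrev sectionComplex (a : Ideal R) (J : CochainComplex (ModuleCat.{u} R) ℤ) :
    CochainComplex (ModuleCat.{u} R) ℤ :=
  ((sectionFunctor a).mapHomologicalComplex (ComplexShape.up ℤ)).obj J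

/-- The inclusion of complexes `Γ_a(J) ⟶ J`. -/
noncomputable def sectionComplexι (a : Ideal R) (J : CochainComplex (ModuleCat.{u} R) ℤ) :
    sectionComplex a J ⟶ J where
  f i := (sectionι a).app (J.X i)
  comm' i j _ := ((sectionι a).naturality (J.d i j)).symm

theorem isTorsionModule_homology_sectionComplex (a : Ideal R)
    (J : CochainComplex (ModuleCat.{u} R) ℤ) (i : ℤ) :
    IsTorsionModule a ((sectionComplex a J).homology i) :=
  ((isTorsionModule_sectionFunctor_obj a (J.X i)).of_mono
    ((sectionComplex a J).iCycles i)).of_epi ((sectionComplex a J).homologyπ i)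

/-- If a bounded below complex `J` of injective modules has `a`-torsion homology, then
`Γ_a(J) ⟶ J` is a quasi-isomorphism. -/
theorem isZero_homology_sectionComplex_iff [IsNoetherianRing R] {a : Ideal R}
    (J : CochainComplex (ModuleCat.{u} R) ℤ) (hinj : ∀ i, Injective (J.X i))
    (n : ℤ) (hn : ∀ i < n, Limits.IsZero (J.X i))
    (hH : ∀ i, IsTorsionModule a (J.homology i)) (i : ℤ) :
    Limits.IsZero ((sectionComplex a J).homology i) ↔ Limits.IsZero (J.homology i) := by
  have hmono : Mono (sectionComplexι a J) := by
    have : ∀ i, Mono ((sectionComplexι a J).f i) := fun i =>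
      (ModuleCat.mono_iff_injective _).2 Subtype.val_injective
    exact HomologicalComplex.mono_of_mono_f _ this
  let S := ShortComplex.mk (sectionComplexι a J) (Limits.cokernel.π (sectionComplexι a J))
    (Limits.cokernel.condition _)
  have hS : S.ShortExact :=
    { exact := ShortComplex.exact_of_g_is_cokernel _ (Limits.cokernelIsCokernel _)
      mono_f := hmono
      epi_g := inferInstanceAs (Epi (Limits.cokernel.π _)) }
  have hdeg := fun i => (HomologicalComplex.shortExact_iff_degreewise_shortExact S).1 hS i
  have hinj₁ : ∀ i, Injective ((sectionComplex a J).X i) := fun i =>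
    injective_sectionFunctor_obj a (J.X i)
  have hQ : ∀ i, Limits.IsZero (S.X₃.homology i) := by
    refine isZero_homology_of_torsionFree (a := a) S.X₃ n (fun i hi => ?_) (fun i => ?_)
      (fun i => ?_) fun i => ?_
    · have : Epi (S.g.f i) := (hdeg i).epi_g
      exact (hn i hi).of_epi (S.g.f i)
    · have : Injective (S.map (HomologicalComplex.eval _ _ i)).X₁ := hinj₁ i
      have : Injective (S.map (HomologicalComplex.eval _ _ i)).X₂ := hinj i
      exact injective_X₃ (hdeg i)
    · exact torsionFree_of_section (J.X i) (S.g.f i) (HomologicalComplex.congr_hom S.zero i)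
        (hdeg i)
    · exact IsTorsionModule.of_exact _ (hS.homology_exact₃ i (i + 1) (by simp)) (hH i)
        (isTorsionModule_homology_sectionComplex a J (i + 1))
  have hmap : IsIso (HomologicalComplex.homologyMap S.f i) := by
    have h1 : Mono (HomologicalComplex.homologyMap S.f i) :=
      (hS.homology_exact₁ (i - 1) i (by simp)).mono_g ((hQ _).eq_of_src _ _)
    have h2 : Epi (HomologicalComplex.homologyMap S.f i) :=
      (hS.homology_exact₂ i).epi_f ((hQ _).eq_of_tgt _ _)
    exact isIso_of_mono_of_epi _
  exact (asIso (HomologicalComplex.homologyMap S.f i)).isZero_iff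

/-! ### Morphisms in the derived category from a module to a K-injective complex -/

section Derived

open CochainComplex.HomComplex

attribute [local instance] HasDerivedCategory.standard

theorem exists_Q_map_eq {C : Type*} [Category* C] [Abelian C] {K J : CochainComplex C ℤ}
    [J.IsKInjective] (f : DerivedCategory.Q.obj K ⟶ DerivedCategory.Q.obj J) :
    ∃ φ : K ⟶ J, DerivedCategory.Q.map φ = f := by
  obtain ⟨ψ, hψ⟩ := (CochainComplex.IsKInjective.Qh_map_bijective
    ((HomotopyCategory.quotient _ _).obj K) J).surjective
      ((DerivedCategory.quotientCompQhIso _).hom.app K ≫ f ≫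
        (DerivedCategory.quotientCompQhIso _).inv.app J)
  obtain ⟨φ, rfl⟩ := (HomotopyCategory.quotient _ _).map_surjective ψ
  refine ⟨φ, ?_⟩
  rw [← cancel_epi ((DerivedCategory.quotientCompQhIso _).hom.app K),
    ← DerivedCategory.quotientCompQhIso_hom_naturality, hψ]
  simp

theorem Q_map_eq_zero_iff {C : Type*} [Category* C] [Abelian C] {K J : CochainComplex C ℤ}
    [J.IsKInjective] (φ : K ⟶ J) :
    DerivedCategory.Q.map φ = 0 ↔ Nonempty (Homotopy φ 0) := by
  rw [← HomotopyCategory.quotient_map_eq_zero_iff,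
    ← (CochainComplex.IsKInjective.Qh_map_bijective
      ((HomotopyCategory.quotient _ _).obj K) J).injective.eq_iff, Functor.map_zero,
    ← cancel_epi ((DerivedCategory.quotientCompQhIso C).hom.app K),
    ← DerivedCategory.quotientCompQhIso_hom_naturality, Limits.comp_zero]
  constructor
  · intro h
    rw [← cancel_mono ((DerivedCategory.quotientCompQhIso C).hom.app J), h, Limits.zero_comp]
  · intro h
    rw [h, Limits.zero_comp]

variable {A B : ModuleCat.{u} R} {J : CochainComplex (ModuleCat.{u} R) ℤ} {i : ℤ}

/-- The morphism from `A`, placed in degree `i`, to `J` in the derived category given by a cocycle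
`z : A ⟶ J^i`. -/
noncomputable def singleHom (z : A ⟶ J.X i) (hz : z ≫ J.d i (i + 1) = 0) :
    (DerivedCategory.singleFunctor (ModuleCat.{u} R) i).obj A ⟶ DerivedCategory.Q.obj J :=
  DerivedCategory.Q.map (Cocycle.homOf (Cocycle.fromSingleMk z (add_zero i) (i + 1) rfl hz))

theorem exists_singleHom_eq [J.IsKInjective]
    (f : (DerivedCategory.singleFunctor (ModuleCat.{u} R) i).obj A ⟶ DerivedCategory.Q.obj J) :
    ∃ (z : A ⟶ J.X i) (hz : z ≫ J.d i (i + 1) = 0), singleHom z hz = f := by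
  obtain ⟨φ, rfl⟩ := exists_Q_map_eq (K := (CochainComplex.singleFunctor _ i).obj A) f
  obtain ⟨z, hz, h⟩ := Cocycle.fromSingleMk_surjective (Cocycle.ofHom φ) i (add_zero i) (i + 1) rfl
  exact ⟨z, hz, congrArg _ ((congrArg Cocycle.homOf h).trans (Cocycle.homOf_ofHom_eq_self φ))⟩

theorem singleHom_eq_zero_iff [J.IsKInjective] (z : A ⟶ J.X i) (hz : z ≫ J.d i (i + 1) = 0) :
    singleHom z hz = 0 ↔ ∃ w : A ⟶ J.X (i - 1), w ≫ J.d (i - 1) i = z := by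
  refine (Q_map_eq_zero_iff
    (Cocycle.homOf (Cocycle.fromSingleMk z (add_zero i) (i + 1) rfl hz))).trans ?_
  rw [← Cocycle.fromSingleMk_mem_coboundaries_iff z (add_zero i) (i + 1) rfl hz (i - 1) (by lia),
    mem_coboundaries_iff _ (-1) (by simp)]
  constructor
  · rintro ⟨h⟩
    obtain ⟨w, hw⟩ := Cochain.equivHomotopy _ _ h
    exact ⟨w, by simpa using hw.symm⟩
  · rintro ⟨w, hw⟩
    exact ⟨(Cochain.equivHomotopy _ _).symm ⟨w, by simpa using hw.symm⟩⟩

theorem map_comp_singleHom (g : B ⟶ A) (z : A ⟶ J.X i) (hz : z ≫ J.d i (i + 1) = 0) :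
    (DerivedCategory.singleFunctor (ModuleCat.{u} R) i).map g ≫ singleHom z hz =
      singleHom (g ≫ z) (by rw [Category.assoc, hz, Limits.comp_zero]) := by
  have h : (CochainComplex.singleFunctor _ i).map g ≫
      Cocycle.homOf (Cocycle.fromSingleMk z (add_zero i) (i + 1) rfl hz) =
      Cocycle.homOf (Cocycle.fromSingleMk (g ≫ z) (add_zero i) (i + 1) rfl
        (by rw [Category.assoc, hz, Limits.comp_zero])) := by
    apply Cochain.ofHom_injective
    rw [Cochain.ofHom_comp, Cocycle.cochain_ofHom_homOf_eq_coe,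
      Cocycle.cochain_ofHom_homOf_eq_coe, Cocycle.fromSingleMk_coe, Cocycle.fromSingleMk_coe,
      Cochain.fromSingleMk_precomp]
  exact ((DerivedCategory.Q.map_comp _ _).symm.trans (congrArg _ h))

/-- The projection `R ⧸ a ^ N ⟶ R ⧸ a ^ n` for `n ≤ N`. -/
noncomputable def powProj (a : Ideal R) {n N : ℕ} (h : n ≤ N) :
    ModuleCat.of R (R ⧸ a ^ N) ⟶ ModuleCat.of R (R ⧸ a ^ n) :=
  ModuleCat.ofHom (Submodule.factor (Ideal.pow_le_pow_right h))

theorem powProj_comp (a : Ideal R) {n N M : ℕ} (h : n ≤ N) (h' : N ≤ M) :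
    powProj a h' ≫ powProj a h = powProj a (h.trans h') := by
  refine ModuleCat.hom_ext (LinearMap.ext fun x => ?_)
  obtain ⟨x, rfl⟩ := Submodule.mkQ_surjective _ x
  rfl

/-- The vanishing of `colim_n Hom(R ⧸ a ^ n, W[i])`, the morphisms being those of the derived category:
every morphism to `W` from `R ⧸ a ^ n` placed in degree `i` becomes zero on some `R ⧸ a ^ N`. For `W`
homologically bounded to the left this colimit is `H^i(RΓ_a(W))`. -/
def LocalCohomologyVanishes (a : Ideal R) (i : ℤ) (W : DerivedCategory (ModuleCat.{u} R)) : Prop :=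
  ∀ (n : ℕ) (f : (DerivedCategory.singleFunctor (ModuleCat.{u} R) i).obj
    (ModuleCat.of R (R ⧸ a ^ n)) ⟶ W), ∃ (N : ℕ) (h : n ≤ N),
      (DerivedCategory.singleFunctor (ModuleCat.{u} R) i).map (powProj a h) ≫ f = 0

theorem LocalCohomologyVanishes.of_iso {a : Ideal R} {W W' : DerivedCategory (ModuleCat.{u} R)}
    (h : LocalCohomologyVanishes a i W) (e : W ≅ W') : LocalCohomologyVanishes a i W' := by
  intro n f
  obtain ⟨N, hN, h0⟩ := h n (f ≫ e.inv)
  exact ⟨N, hN, by rw [← cancel_mono e.inv, Category.assoc, h0, Limits.zero_comp]⟩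

theorem LocalCohomologyVanishes.of_isZero {a : Ideal R} {W : DerivedCategory (ModuleCat.{u} R)}
    (h : Limits.IsZero W) : LocalCohomologyVanishes a i W :=
  fun n _ => ⟨n, le_rfl, h.eq_of_tgt _ _⟩

theorem isZero_homology_iff (K : CochainComplex (ModuleCat.{u} R) ℤ) (i : ℤ) :
    Limits.IsZero (K.homology i) ↔
      ∀ z : K.X i, K.d i (i + 1) z = 0 → ∃ w : K.X (i - 1), K.d (i - 1) i w = z := by
  rw [← HomologicalComplex.exactAt_iff_isZero_homology,
    HomologicalComplex.exactAt_iff' _ (i - 1) i (i + 1) (by simp) (by simp),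
    ShortComplex.moduleCat_exact_iff]
  rfl

/-- The map `R ⧸ b ⟶ M` given by an element killed by `b`. -/
noncomputable def quotientHom (b : Ideal R) {M : ModuleCat.{u} R} (x : M)
    (hx : ∀ r ∈ b, r • x = 0) : ModuleCat.of R (R ⧸ b) ⟶ M :=
  ModuleCat.ofHom (Submodule.liftQ b (LinearMap.toSpanSingleton R M x) hx)

theorem quotient_hom_ext {b : Ideal R} {M : ModuleCat.{u} R} {f g : ModuleCat.of R (R ⧸ b) ⟶ M}
    (h : f (Submodule.mkQ b (1 : R)) = g (Submodule.mkQ b (1 : R))) : f = g := by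
  refine ModuleCat.hom_ext (LinearMap.ext fun x => ?_)
  obtain ⟨r, rfl⟩ := Submodule.mkQ_surjective _ x
  have hr : Submodule.mkQ b r = r • Submodule.mkQ b (1 : R) := by
    rw [← map_smul, smul_eq_mul, mul_one]
  rw [hr]
  exact (map_smul f.hom r _).trans ((congrArg (r • ·) h).trans (map_smul g.hom r _).symm)

theorem quotientHom_one (b : Ideal R) {M : ModuleCat.{u} R} (x : M)
    (hx : ∀ r ∈ b, r • x = 0) : quotientHom b x hx (Submodule.mkQ b (1 : R)) = x :=
  one_smul R x

theorem smul_apply_one {b : Ideal R} {M : ModuleCat.{u} R} (f : ModuleCat.of R (R ⧸ b) ⟶ M)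
    (r : R) (hr : r ∈ b) : r • f (Submodule.mkQ b (1 : R)) = 0 := by
  rw [← map_smul, ← map_smul, smul_eq_mul, mul_one]
  have : Submodule.mkQ b r = 0 := (Submodule.Quotient.mk_eq_zero _).2 hr
  rw [this, map_zero]

theorem localCohomologyVanishes_iff (a : Ideal R) [J.IsKInjective] :
    LocalCohomologyVanishes a i (DerivedCategory.Q.obj J) ↔
      Limits.IsZero ((sectionComplex a J).homology i) := by
  rw [isZero_homology_iff]
  constructor
  · rintro h ⟨z, n, hn⟩ hz
    have hz' : J.d i (i + 1) z = 0 := congrArg Subtype.val hz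
    obtain ⟨N, hN, h0⟩ := h n (singleHom (quotientHom (a ^ n) z hn) (quotient_hom_ext (by
      rw [ModuleCat.comp_apply, quotientHom_one, hz']; rfl)))
    rw [map_comp_singleHom, singleHom_eq_zero_iff] at h0
    obtain ⟨w, hw⟩ := h0
    refine ⟨⟨w (Submodule.mkQ (a ^ N) (1 : R)), N, smul_apply_one w⟩, Subtype.ext ?_⟩
    exact (ConcreteCategory.congr_hom hw (Submodule.mkQ (a ^ N) (1 : R))).trans
      (quotientHom_one (a ^ n) z hn)
  · intro h n f
    obtain ⟨z, hz, rfl⟩ := exists_singleHom_eq f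
    obtain ⟨⟨w, m, hm⟩, hw⟩ := h ⟨z (Submodule.mkQ (a ^ n) (1 : R)), n, smul_apply_one z⟩
      (Subtype.ext (ConcreteCategory.congr_hom hz _))
    refine ⟨max n m, le_max_left _ _, ?_⟩
    rw [map_comp_singleHom, singleHom_eq_zero_iff]
    refine ⟨quotientHom _ w fun r hr => hm r (Ideal.pow_le_pow_right (le_max_right n m) hr),
      quotient_hom_ext ?_⟩
    rw [ModuleCat.comp_apply, quotientHom_one]
    exact congrArg Subtype.val hw

theorem LocalCohomologyVanishes.of_distTriang {a : Ideal R}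
    (T : Pretriangulated.Triangle (DerivedCategory (ModuleCat.{u} R)))
    (hT : T ∈ Pretriangulated.distinguishedTriangles)
    (h₁ : LocalCohomologyVanishes a i T.obj₁) (h₃ : LocalCohomologyVanishes a i T.obj₃) :
    LocalCohomologyVanishes a i T.obj₂ := by
  intro n f
  obtain ⟨N, hN, h0⟩ := h₃ n (f ≫ T.mor₂)
  obtain ⟨g, hg⟩ := Pretriangulated.Triangle.coyoneda_exact₂ T hT _
    ((Category.assoc _ _ _).trans h0)
  obtain ⟨M, hM, h0'⟩ := h₁ N g
  refine ⟨M, hN.trans hM, ?_⟩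
  rw [← powProj_comp a hN hM, Functor.map_comp, Category.assoc, hg, reassoc_of% h0',
    Limits.zero_comp]

/-- If `x ∈ a` and the local cohomology of the fibre of `x : W ⟶ W` vanishes in degree `i`, then `x` is
injective on the local cohomology of `W` in degree `i`, all of whose elements are killed by a power
of `x`. -/
theorem LocalCohomologyVanishes.of_smul {a : Ideal R} {x : R} (hx : x ∈ a)
    (T : Pretriangulated.Triangle (DerivedCategory (ModuleCat.{u} R)))
    (hT : T ∈ Pretriangulated.distinguishedTriangles)
    (e : T.obj₂ ≅ T.obj₃) (he : T.mor₂ = x • e.hom)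
    (h₁ : LocalCohomologyVanishes a i T.obj₁) : LocalCohomologyVanishes a i T.obj₂ := by
  have key : ∀ (k n : ℕ) (f : (DerivedCategory.singleFunctor (ModuleCat.{u} R) i).obj
      (ModuleCat.of R (R ⧸ a ^ n)) ⟶ T.obj₂), x ^ k • f = 0 → ∃ (N : ℕ) (h : n ≤ N),
      (DerivedCategory.singleFunctor (ModuleCat.{u} R) i).map (powProj a h) ≫ f = 0 := by
    intro k
    induction k with
    | zero =>
      intro n f hf
      rw [pow_zero, one_smul] at hf
      exact ⟨n, le_rfl, by rw [hf, Limits.comp_zero]⟩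
    | succ k ih =>
      intro n f hf
      obtain ⟨g, hg⟩ := Pretriangulated.Triangle.coyoneda_exact₂ T hT (x ^ k • f) (by
        rw [he, Linear.comp_smul, Linear.smul_comp, smul_smul, ← pow_succ',
          ← Linear.smul_comp, hf, Limits.zero_comp])
      obtain ⟨N, hN, h0⟩ := h₁ n g
      obtain ⟨M, hM, h0'⟩ := ih N
        ((DerivedCategory.singleFunctor (ModuleCat.{u} R) i).map (powProj a hN) ≫ f) (by
          rw [← Linear.comp_smul, hg, reassoc_of% h0, Limits.zero_comp])
      refine ⟨M, hN.trans hM, ?_⟩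
      rw [← powProj_comp a hN hM, Functor.map_comp, Category.assoc, h0']
  intro n f
  refine key n n f ?_
  have h1 : x ^ n • 𝟙 (ModuleCat.of R (R ⧸ a ^ n)) = 0 :=
    quotient_hom_ext (smul_apply_one (𝟙 _) _ (Ideal.pow_mem_pow hx n))
  rw [← Category.id_comp f, ← (DerivedCategory.singleFunctor (ModuleCat.{u} R) i).map_id,
    ← Linear.smul_comp, ← Functor.map_smul, h1, Functor.map_zero, Limits.zero_comp]

end Derived

/-! ### The complexes `Hom(X, I)` for a complex `I` of injectives -/

section HomComplexes

open CochainComplex.HomComplex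

/-- An elementwise criterion for a morphism of complexes of modules to be a quasi-isomorphism. -/
theorem quasiIso_of_elementwise {K L : CochainComplex (ModuleCat.{u} R) ℤ} (f : K ⟶ L)
    (hsurj : ∀ (n : ℤ) (y : L.X n), L.d n (n + 1) y = 0 →
      ∃ x : K.X n, K.d n (n + 1) x = 0 ∧ ∃ w : L.X (n - 1), f.f n x = y + L.d (n - 1) n w)
    (hinj : ∀ (n : ℤ) (x : K.X n) (w : L.X (n - 1)), K.d n (n + 1) x = 0 →
      f.f n x = L.d (n - 1) n w → ∃ v : K.X (n - 1), K.d (n - 1) n v = x) :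
    QuasiIso f := by
  have hcyc : ∀ (M : CochainComplex (ModuleCat.{u} R) ℤ) (n : ℤ) (y : M.X n),
      M.d n (n + 1) y = 0 → ∃ z : M.cycles n, M.iCycles n z = y := fun M n =>
    (ShortComplex.moduleCat_exact_iff _).1 (ShortComplex.exact_of_f_is_kernel
      (ShortComplex.mk (M.iCycles n) (M.d n (n + 1)) (by simp))
      (M.cyclesIsKernel n (n + 1) (by simp)))
  have hbd : ∀ (M : CochainComplex (ModuleCat.{u} R) ℤ) (n : ℤ) (z : M.cycles n),
      M.homologyπ n z = 0 → ∃ w : M.X (n - 1), M.toCycles (n - 1) n w = z := fun M n =>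
    (ShortComplex.moduleCat_exact_iff _).1 (ShortComplex.exact_of_g_is_cokernel
      (ShortComplex.mk (M.toCycles (n - 1) n) (M.homologyπ n) (by simp))
      (M.homologyIsCokernel (n - 1) n (by simp)))
  have hi : ∀ (M : CochainComplex (ModuleCat.{u} R) ℤ) (n : ℤ),
      Function.Injective (M.iCycles n) := fun M n =>
    (ModuleCat.mono_iff_injective _).1 inferInstance
  have hπ : ∀ (M : CochainComplex (ModuleCat.{u} R) ℤ) (n : ℤ),
      Function.Surjective (M.homologyπ n) := fun M n =>
    (ModuleCat.epi_iff_surjective _).1 inferInstance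
  have hti : ∀ (M : CochainComplex (ModuleCat.{u} R) ℤ) (n : ℤ) (w : M.X (n - 1)),
      M.iCycles n (M.toCycles (n - 1) n w) = M.d (n - 1) n w := fun M n w =>
    ConcreteCategory.congr_hom (M.toCycles_i (n - 1) n) w
  have htπ : ∀ (M : CochainComplex (ModuleCat.{u} R) ℤ) (n : ℤ) (w : M.X (n - 1)),
      M.homologyπ n (M.toCycles (n - 1) n w) = 0 := fun M n w =>
    ConcreteCategory.congr_hom (M.toCycles_comp_homologyπ (n - 1) n) w
  have hiK : ∀ n (z : K.cycles n), K.d n (n + 1) (K.iCycles n z) = 0 := fun n z =>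
    ConcreteCategory.congr_hom (K.iCycles_d n (n + 1)) z
  have hiL : ∀ n (z : L.cycles n), L.d n (n + 1) (L.iCycles n z) = 0 := fun n z =>
    ConcreteCategory.congr_hom (L.iCycles_d n (n + 1)) z
  have hfi : ∀ n (z : K.cycles n), L.iCycles n (HomologicalComplex.cyclesMap f n z) =
      f.f n (K.iCycles n z) := fun n z =>
    ConcreteCategory.congr_hom (HomologicalComplex.cyclesMap_i f n) z
  have hfπ : ∀ n (z : K.cycles n), HomologicalComplex.homologyMap f n (K.homologyπ n z) =
      L.homologyπ n (HomologicalComplex.cyclesMap f n z) := fun n z =>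
    ConcreteCategory.congr_hom (HomologicalComplex.homologyπ_naturality f n) z
  refine ⟨fun n => ?_⟩
  rw [quasiIsoAt_iff_isIso_homologyMap, ConcreteCategory.isIso_iff_bijective]
  constructor
  · refine (injective_iff_map_eq_zero (HomologicalComplex.homologyMap f n).hom).2 fun h hh => ?_
    obtain ⟨z, rfl⟩ := hπ K n h
    obtain ⟨w, hw⟩ := hbd L n _ ((hfπ n z).symm.trans hh)
    obtain ⟨v, hv⟩ := hinj n (K.iCycles n z) w (hiK n z) (by rw [← hfi, ← hw, hti])
    have : K.toCycles (n - 1) n v = z := hi K n (by rw [hti, hv])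
    rw [← this, htπ]
  · intro h
    obtain ⟨z, rfl⟩ := hπ L n h
    obtain ⟨x, hx, w, hw⟩ := hsurj n (L.iCycles n z) (hiL n z)
    obtain ⟨z', rfl⟩ := hcyc K n x hx
    refine ⟨K.homologyπ n z', ?_⟩
    have h1 : HomologicalComplex.cyclesMap f n z' = z + L.toCycles (n - 1) n w :=
      hi L n (by rw [hfi, hw, map_add, hti])
    rw [hfπ, h1, map_add, htπ, add_zero]

/-- The morphism `Hom(X, I) ⟶ Hom(X', I)` induced by `X' ⟶ X`. -/
noncomputable def homComplexMap {X X' : CochainComplex (ModuleCat.{u} R) ℤ} (φ : X' ⟶ X)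
    (I : CochainComplex (ModuleCat.{u} R) ℤ) : homComplex X I ⟶ homComplex X' I where
  f n := ModuleCat.ofHom
    { toFun := fun z : Cochain X I n => (Cochain.ofHom φ).comp z (zero_add n)
      map_add' := fun z z' => Cochain.comp_add _ _ _ _
      map_smul' := fun r z => Cochain.comp_smul _ _ _ _ }
  comm' n m _ := by
    refine ModuleCat.hom_ext (LinearMap.ext fun z => ?_)
    exact δ_ofHom_comp φ z m

attribute [local instance] HasDerivedCategory.standard in
theorem mem_coboundaries_iff_Q_map {X I : CochainComplex (ModuleCat.{u} R) ℤ} [I.IsKInjective]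
    {n : ℤ} (c : Cocycle X I n) :
    c ∈ coboundaries X I n ↔ DerivedCategory.Q.map (Cocycle.equivHomShift.symm c) = 0 := by
  rw [← CohomologyClass.toHom_mk_eq_zero_iff, Q_map_eq_zero_iff, CohomologyClass.toHom_mk,
    HomotopyCategory.quotient_map_eq_zero_iff]

attribute [local instance] HasDerivedCategory.standard in
theorem quasiIso_homComplexMap {X X' : CochainComplex (ModuleCat.{u} R) ℤ} (φ : X' ⟶ X)
    [hφ : QuasiIso φ] (I : CochainComplex (ModuleCat.{u} R) ℤ) [I.IsKInjective] :
    QuasiIso (homComplexMap φ I) := by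
  have hQ : IsIso (DerivedCategory.Q.map φ) := (DerivedCategory.isIso_Q_map_iff_quasiIso _ φ).2 hφ
  refine quasiIso_of_elementwise _ (fun n (y : Cochain X' I n) hy => ?_)
    fun n (x : Cochain X I n) (w : Cochain X' I (n - 1)) hx hw => ?_
  · let c : Cocycle X' I n := Cocycle.mk y (n + 1) rfl hy
    obtain ⟨ξ, hξ⟩ := exists_Q_map_eq
      (inv (DerivedCategory.Q.map φ) ≫ DerivedCategory.Q.map (Cocycle.equivHomShift.symm c))
    let b : Cocycle X I n := Cocycle.equivHomShift ξ
    have h : b.precomp φ - c ∈ coboundaries X' I n := by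
      rw [mem_coboundaries_iff_Q_map, map_sub, Cocycle.equivHomShift_symm_precomp,
        AddEquiv.symm_apply_apply, Functor.map_sub, Functor.map_comp, hξ, IsIso.hom_inv_id_assoc,
        sub_self]
    obtain ⟨w, hw⟩ := (mem_coboundaries_iff _ (n - 1) (by lia)).1 h
    refine ⟨b.1, b.δ_eq_zero (n + 1), w, ?_⟩
    exact eq_add_of_sub_eq' hw.symm
  · let c : Cocycle X I n := Cocycle.mk x (n + 1) rfl hx
    have h : c.precomp φ ∈ coboundaries X' I n :=
      (mem_coboundaries_iff _ (n - 1) (by lia)).2 ⟨w, hw.symm⟩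
    rw [mem_coboundaries_iff_Q_map, Cocycle.equivHomShift_symm_precomp, Functor.map_comp] at h
    have h' : c ∈ coboundaries X I n := by
      rw [mem_coboundaries_iff_Q_map, ← cancel_epi (DerivedCategory.Q.map φ), h,
        Limits.comp_zero]
    obtain ⟨v, hv⟩ := (mem_coboundaries_iff _ (n - 1) (by lia)).1 h'
    exact ⟨v, hv⟩

/-- The complex `Hom_R(M, I)` of a module `M` and a complex `I`, with
`Hom_R(M, I)^n = Hom_R(M, I^n)`. -/
noncomputable def homFrom (M : ModuleCat.{u} R) (I : CochainComplex (ModuleCat.{u} R) ℤ) :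
    CochainComplex (ModuleCat.{u} R) ℤ :=
  (((linearCoyoneda R (ModuleCat.{u} R)).obj (Opposite.op M)).mapHomologicalComplex _).obj I

/-- The morphism `Hom_R(N, I) ⟶ Hom_R(M, I)` induced by `M ⟶ N`. -/
noncomputable def homFromMap {M N : ModuleCat.{u} R} (f : M ⟶ N)
    (I : CochainComplex (ModuleCat.{u} R) ℤ) : homFrom N I ⟶ homFrom M I :=
  (NatTrans.mapHomologicalComplex ((linearCoyoneda R (ModuleCat.{u} R)).map f.op) _).app I

theorem isZero_homology_homFrom_iff {M : ModuleCat.{u} R}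
    (I : CochainComplex (ModuleCat.{u} R) ℤ) (n : ℤ) :
    Limits.IsZero ((homFrom M I).homology n) ↔
      ∀ z : M ⟶ I.X n, z ≫ I.d n (n + 1) = 0 → ∃ w : M ⟶ I.X (n - 1), w ≫ I.d (n - 1) n = z :=
  isZero_homology_iff _ n

/-- `Hom(M, I)` does not depend on whether `M` is regarded as a module or as a complex. -/
noncomputable def homComplexIsoHomFrom (M : ModuleCat.{u} R)
    (I : CochainComplex (ModuleCat.{u} R) ℤ) : homComplex (ofModule M) I ≅ homFrom M I :=
  HomologicalComplex.Hom.isoOfComponents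
    (fun n => LinearEquiv.toModuleIso
      ({ (Cochain.fromSingleEquiv (X := M) (K := I) (zero_add n)) with
        map_smul' := fun r z => by
          change _ ≫ (r • z).v 0 n (zero_add n) = r • (_ ≫ z.v 0 n (zero_add n))
          exact (congrArg (_ ≫ ·) (Cochain.smul_v r z 0 n (zero_add n))).trans
            (Linear.comp_smul _ _ _ _ _ _) } :
        Cochain (ofModule M) I n ≃ₗ[R] (M ⟶ I.X n)))
    fun n m _ => by
      refine ModuleCat.hom_ext (LinearMap.ext fun (z : Cochain (ofModule M) I n) => ?_)
      obtain ⟨f, rfl⟩ := Cochain.fromSingleMk_surjective z n (zero_add n)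
      have h1 : Cochain.fromSingleEquiv (zero_add m)
          (δ n m (Cochain.fromSingleMk f (zero_add n))) =
          Cochain.fromSingleEquiv (zero_add n) (Cochain.fromSingleMk f (zero_add n)) ≫ I.d n m := by
        rw [Cochain.δ_fromSingleMk f (zero_add n) m m (zero_add m),
          Cochain.fromSingleEquiv_fromSingleMk, Cochain.fromSingleEquiv_fromSingleMk]
      exact h1.symm

/-- The sequence `Hom(X₃, I) ⟶ Hom(X₂, I) ⟶ Hom(X₁, I)` of complexes. -/
noncomputable def homFromShortComplex (S : ShortComplex (ModuleCat.{u} R))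
    (I : CochainComplex (ModuleCat.{u} R) ℤ) :
    ShortComplex (CochainComplex (ModuleCat.{u} R) ℤ) :=
  ShortComplex.mk (homFromMap S.g I) (homFromMap S.f I) (by
    ext n : 1
    refine ModuleCat.hom_ext (LinearMap.ext fun (z : S.X₃ ⟶ I.X n) => ?_)
    change S.f ≫ S.g ≫ z = 0
    rw [S.zero_assoc, Limits.zero_comp])

theorem homFromShortComplex_shortExact {S : ShortComplex (ModuleCat.{u} R)} (hS : S.ShortExact)
    {I : CochainComplex (ModuleCat.{u} R) ℤ} (hI : ∀ n, Injective (I.X n)) :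
    (homFromShortComplex S I).ShortExact := by
  refine HomologicalComplex.shortExact_of_degreewise_shortExact _ fun n => ?_
  have := hI n
  have := hS.epi_g
  have := hS.mono_f
  refine { exact := (ShortComplex.moduleCat_exact_iff _).2 fun (z : S.X₂ ⟶ I.X n)
              (hz : S.f ≫ z = 0) => ?_
           mono_f := (ModuleCat.mono_iff_injective _).2 ?_
           epi_g := (ModuleCat.epi_iff_surjective _).2 ?_ }
  · exact ⟨hS.exact.desc z hz, hS.exact.g_desc z hz⟩
  · intro (z : S.X₃ ⟶ I.X n) (z' : S.X₃ ⟶ I.X n) (h : S.g ≫ z = S.g ≫ z')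
    exact (cancel_epi S.g).1 h
  · intro (z : S.X₁ ⟶ I.X n)
    exact ⟨(Injective.factorThru z S.f : S.X₂ ⟶ I.X n), Injective.comp_factorThru z S.f⟩

/-- A complex with finitely generated homology concentrated in degree `0` is quasi-isomorphic to a
finitely generated module, by truncating on both sides. -/
theorem exists_iso_Q_homFrom {X : CochainComplex (ModuleCat.{u} R) ℤ} (hX : DegZeroFG X)
    [HasDerivedCategory (ModuleCat.{u} R)] :
    ∃ M : ModuleCat.{u} R, Module.Finite R M ∧
      ∀ (I : CochainComplex (ModuleCat.{u} R) ℤ) [I.IsKInjective],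
        Nonempty (DerivedCategory.Q.obj (homComplex X I) ≅
          DerivedCategory.Q.obj (homFrom M I)) := by
  have hLE : X.IsLE 0 := (X.isLE_iff 0).2 fun i hi =>
    (X.exactAt_iff_isZero_homology i).2 (hX.conc i hi.ne')
  have hGE : X.IsGE 0 := (X.isGE_iff 0).2 fun i hi =>
    (X.exactAt_iff_isZero_homology i).2 (hX.conc i hi.ne)
  have hGE' : (X.truncLE 0).IsGE 0 := ((X.truncLE 0).isGE_iff 0).2 fun i hi => by
    have h1 := (X.isGE_iff 0).1 hGE i hi
    rw [HomologicalComplex.exactAt_iff_isZero_homology] at h1 ⊢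
    exact (asIso (HomologicalComplex.homologyMap (X.ιTruncLE 0) i)).isZero_iff.2 h1
  obtain ⟨M, ⟨e⟩⟩ := ((X.truncLE 0).truncGE 0).exists_iso_single 0
  refine ⟨M, ?_, fun I _ => ?_⟩
  · have e₁ := (HomologicalComplex.homologyFunctorSingleIso (ModuleCat.{u} R)
      (ComplexShape.up ℤ) 0).app M
    have e₂ := (asIso (HomologicalComplex.homologyMap (X.ιTruncLE 0) 0)).symm ≪≫
      asIso (HomologicalComplex.homologyMap ((X.truncLE 0).πTruncGE 0) 0) ≪≫
      HomologicalComplex.homologyMapIso e 0 ≪≫ e₁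
    have := hX.fg 0
    exact Module.Finite.equiv e₂.toLinearEquiv
  · have h1 := quasiIso_homComplexMap (X.ιTruncLE 0) I
    have h2 := quasiIso_homComplexMap ((X.truncLE 0).πTruncGE 0) I
    have h3 := quasiIso_homComplexMap e.inv I
    rw [← DerivedCategory.isIso_Q_map_iff_quasiIso] at h1 h2 h3
    exact ⟨asIso (DerivedCategory.Q.map (homComplexMap (X.ιTruncLE 0) I)) ≪≫
      (asIso (DerivedCategory.Q.map (homComplexMap ((X.truncLE 0).πTruncGE 0) I))).symm ≪≫
      asIso (DerivedCategory.Q.map (homComplexMap e.inv I)) ≪≫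
      DerivedCategory.Q.mapIso (homComplexIsoHomFrom M I)⟩

end HomComplexes

/-! ### Dévissage along cyclic modules -/

section Devissage

theorem shortExact_of_linearMap {M N P : Type u} [AddCommGroup M] [Module R M] [AddCommGroup N]
    [Module R N] [AddCommGroup P] [Module R P] (f : M →ₗ[R] N) (g : N →ₗ[R] P)
    (hf : Function.Injective f) (hg : Function.Surjective g) (h : Function.Exact f g) :
    (ShortComplex.mk (ModuleCat.ofHom f) (ModuleCat.ofHom g)
      (ModuleCat.hom_ext h.linearMap_comp_eq_zero)).ShortExact where
  exact := (ShortComplex.moduleCat_exact_iff _).2 fun x hx => (h x).1 hx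
  mono_f := (ModuleCat.mono_iff_injective _).2 hf
  epi_g := (ModuleCat.epi_iff_surjective _).2 hg

/-- Multiplication by `x` and the projection fit into an exact sequence
`0 ⟶ R ⧸ (a : x) ⟶ R ⧸ a ⟶ R ⧸ (a + (x)) ⟶ 0`. -/
theorem exact_mapQ_factor {a b : Ideal R} {x : R} (hb : ∀ r, r ∈ b ↔ x * r ∈ a) :
    Function.Injective (Submodule.mapQ b a (LinearMap.mulLeft R x) fun r hr => (hb r).1 hr) ∧
    Function.Surjective (Submodule.factor (le_sup_left : a ≤ a ⊔ Ideal.span {x})) ∧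
    Function.Exact (Submodule.mapQ b a (LinearMap.mulLeft R x) fun r hr => (hb r).1 hr)
      (Submodule.factor (le_sup_left : a ≤ a ⊔ Ideal.span {x})) := by
  refine ⟨?_, ?_, ?_⟩
  · refine (injective_iff_map_eq_zero _).2 fun y hy => ?_
    obtain ⟨r, rfl⟩ := Submodule.mkQ_surjective _ y
    exact (Submodule.Quotient.mk_eq_zero _).2
      ((hb r).2 ((Submodule.Quotient.mk_eq_zero _).1 hy))
  · intro y
    obtain ⟨r, rfl⟩ := Submodule.mkQ_surjective _ y
    exact ⟨Submodule.mkQ _ r, rfl⟩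
  · intro y
    obtain ⟨r, rfl⟩ := Submodule.mkQ_surjective _ y
    constructor
    · intro h
      have h1 : r ∈ a ⊔ Ideal.span {x} := (Submodule.Quotient.mk_eq_zero _).1 h
      obtain ⟨s, hs, t, ht, rfl⟩ := Submodule.mem_sup.1 h1
      obtain ⟨c, rfl⟩ := Ideal.mem_span_singleton'.1 ht
      refine ⟨Submodule.mkQ _ c, ?_⟩
      refine (Submodule.Quotient.eq _).2 ?_
      have : x * c - (s + c * x) = -s := by ring
      exact this ▸ a.neg_mem hs
    · rintro ⟨z, hz⟩
      obtain ⟨c, rfl⟩ := Submodule.mkQ_surjective _ z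
      rw [← hz]
      exact (Submodule.Quotient.mk_eq_zero _).2 (Submodule.mem_sup_right
        (Ideal.mem_span_singleton'.2 ⟨c, mul_comm _ _⟩))

/-- Noetherian induction for properties of the cyclic modules `R ⧸ a` over a local ring. -/
theorem cyclic_induction [IsNoetherianRing R] [IsLocalRing R] {P : Ideal R → Prop}
    (htop : P ⊤) (hmax : P (IsLocalRing.maximalIdeal R))
    (hext : ∀ (a b : Ideal R) (x : R), (∀ r, r ∈ b ↔ x * r ∈ a) → P b → P (a ⊔ Ideal.span {x}) →
      P a)
    (hprime : ∀ (p : Ideal R) (x : R), p.IsPrime → x ∉ p → x ∈ IsLocalRing.maximalIdeal R →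
      P (p ⊔ Ideal.span {x}) → P p) (a : Ideal R) : P a := by
  induction a using WellFoundedGT.induction with
  | ind a ih =>
  have hlt : ∀ x ∉ a, a < a ⊔ Ideal.span {x} := fun x hx =>
    lt_of_le_of_ne le_sup_left fun h => hx (h ▸ Submodule.mem_sup_right
      (Ideal.mem_span_singleton_self x))
  by_cases h1 : a = ⊤
  · exact h1 ▸ htop
  by_cases hp : a.IsPrime
  · by_cases hm : a = IsLocalRing.maximalIdeal R
    · exact hm ▸ hmax
    obtain ⟨x, hx, hxa⟩ := SetLike.exists_of_lt
      (lt_of_le_of_ne (IsLocalRing.le_maximalIdeal h1) hm)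
    exact hprime a x hp hxa hx (ih _ (hlt x hxa))
  · obtain ⟨x, y, hxy, hx, hy⟩ : ∃ x y, x * y ∈ a ∧ x ∉ a ∧ y ∉ a := by
      by_contra! hcon
      exact hp ⟨h1, fun {x y} hxy => or_iff_not_imp_left.2 (hcon x y hxy)⟩
    refine hext a (Submodule.comap (LinearMap.mulLeft R x) a) x (fun r => Iff.rfl) (ih _ ?_)
      (ih _ (hlt x hx))
    exact SetLike.lt_iff_le_and_exists.2 ⟨fun r hr => a.mul_mem_left x hr, y, hxy, hy⟩

end Devissage

section Cohomology

variable {I : CochainComplex (ModuleCat.{u} R) ℤ}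

theorem homFromMap_smul_id (x : R) (M : ModuleCat.{u} R)
    (I : CochainComplex (ModuleCat.{u} R) ℤ) :
    homFromMap (x • 𝟙 M) I = x • 𝟙 (homFrom M I) := by
  ext n : 1
  refine ModuleCat.hom_ext (LinearMap.ext fun (z : M ⟶ I.X n) => ?_)
  exact (Linear.smul_comp _ _ _ _ _ _).trans (congrArg (x • ·) (Category.id_comp z))

theorem isZero_homFrom (M : ModuleCat.{u} R) (hM : Limits.IsZero M)
    (I : CochainComplex (ModuleCat.{u} R) ℤ) : Limits.IsZero (homFrom M I) := by
  rw [Limits.IsZero.iff_id_eq_zero]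
  ext n : 1
  refine ModuleCat.hom_ext (LinearMap.ext fun (z : M ⟶ I.X n) => ?_)
  exact hM.eq_of_src _ _

/-- For a prime ideal `p` and `x ∉ p`, the short exact sequence of complexes induced by
`0 ⟶ R ⧸ p ⟶ R ⧸ p ⟶ R ⧸ (p + (x)) ⟶ 0`. -/
theorem exists_shortExact_of_prime (hI : ∀ n, Injective (I.X n)) {p : Ideal R} (hp : p.IsPrime)
    {x : R} (hx : x ∉ p) :
    ∃ (f : homFrom (ModuleCat.of R (R ⧸ p ⊔ Ideal.span {x})) I ⟶
        homFrom (ModuleCat.of R (R ⧸ p)) I)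
      (w : f ≫ (x • 𝟙 (homFrom (ModuleCat.of R (R ⧸ p)) I)) = 0),
      (ShortComplex.mk f (x • 𝟙 (homFrom (ModuleCat.of R (R ⧸ p)) I)) w).ShortExact := by
  have hb : ∀ r, r ∈ p ↔ x * r ∈ p := fun r =>
    ⟨fun h => p.mul_mem_left x h, fun h => (hp.mem_or_mem h).resolve_left hx⟩
  obtain ⟨h1, h2, h3⟩ := exact_mapQ_factor hb
  have hS := homFromShortComplex_shortExact (shortExact_of_linearMap _ _ h1 h2 h3) hI
  have he : ModuleCat.ofHom (Submodule.mapQ p p (LinearMap.mulLeft R x) fun r hr => (hb r).1 hr) =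
      x • 𝟙 (ModuleCat.of R (R ⧸ p)) := by
    refine ModuleCat.hom_ext (LinearMap.ext fun y => ?_)
    obtain ⟨r, rfl⟩ := Submodule.mkQ_surjective _ y
    rfl
  have he' := (congrArg (homFromMap · I) he).trans (homFromMap_smul_id x _ I)
  have key : ∀ {K L : CochainComplex (ModuleCat.{u} R) ℤ} (f : K ⟶ L) (φ ψ : L ⟶ L)
      (w : f ≫ φ = 0), (ShortComplex.mk f φ w).ShortExact → φ = ψ →
      ∃ w' : f ≫ ψ = 0, (ShortComplex.mk f ψ w').ShortExact := by
    rintro K L f φ _ w hS rfl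
    exact ⟨w, hS⟩
  exact ⟨_, key _ _ _ _ hS he'⟩

attribute [local instance] HasDerivedCategory.standard in
/-- If the local cohomology `H^i_𝔪(R ⧸ 𝔪, I)` vanishes, then so does `H^i_𝔪(M, I)` for all finitely
generated modules `M`. The point is that elements of `𝔪` act locally nilpotently on local
cohomology: if `x ∈ 𝔪` lies outside a prime ideal `p`, vanishing for `R ⧸ (p + (x))` makes `x`
injective on `H^i_𝔪(R ⧸ p, I)`. -/
theorem localCohomologyVanishes_homFrom [IsNoetherianRing R] [IsLocalRing R]
    (hI : ∀ n, Injective (I.X n)) (i : ℤ)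
    (hk : LocalCohomologyVanishes (IsLocalRing.maximalIdeal R) i (DerivedCategory.Q.obj
      (homFrom (ModuleCat.of R (R ⧸ IsLocalRing.maximalIdeal R)) I)))
    (M : ModuleCat.{u} R) (hM : Module.Finite R M) :
    LocalCohomologyVanishes (IsLocalRing.maximalIdeal R) i
      (DerivedCategory.Q.obj (homFrom M I)) := by
  have hzero : ∀ N : ModuleCat.{u} R, Limits.IsZero N →
      LocalCohomologyVanishes (IsLocalRing.maximalIdeal R) i
        (DerivedCategory.Q.obj (homFrom N I)) := fun N hN =>
    .of_isZero (DerivedCategory.Q.map_isZero (isZero_homFrom N hN I))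
  have hses : ∀ {S : ShortComplex (ModuleCat.{u} R)}, S.ShortExact →
      LocalCohomologyVanishes (IsLocalRing.maximalIdeal R) i
        (DerivedCategory.Q.obj (homFrom S.X₁ I)) →
      LocalCohomologyVanishes (IsLocalRing.maximalIdeal R) i
        (DerivedCategory.Q.obj (homFrom S.X₃ I)) →
      LocalCohomologyVanishes (IsLocalRing.maximalIdeal R) i
        (DerivedCategory.Q.obj (homFrom S.X₂ I)) := fun hS h₁ h₃ =>
    .of_distTriang _ (DerivedCategory.triangleOfSES_distinguished
      (homFromShortComplex_shortExact hS hI)) h₃ h₁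
  have hcyc : ∀ a : Ideal R, LocalCohomologyVanishes (IsLocalRing.maximalIdeal R) i
      (DerivedCategory.Q.obj (homFrom (ModuleCat.of R (R ⧸ a)) I)) := by
    refine cyclic_induction (hzero _ ?_) hk (fun a b x hb h1 h2 => ?_) fun p x hp hx hxm h => ?_
    · have : Subsingleton (R ⧸ (⊤ : Ideal R)) := Ideal.Quotient.subsingleton_iff.2 rfl
      exact ModuleCat.isZero_of_subsingleton _
    · obtain ⟨e1, e2, e3⟩ := exact_mapQ_factor hb
      exact hses (shortExact_of_linearMap _ _ e1 e2 e3) h1 h2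
    · obtain ⟨f, w, hS⟩ := exists_shortExact_of_prime hI hp hx
      refine LocalCohomologyVanishes.of_smul hxm (DerivedCategory.triangleOfSES hS)
        (DerivedCategory.triangleOfSES_distinguished hS) (Iso.refl _) ?_ h
      exact (Functor.map_smul _ _ _).trans (congrArg (x • ·) (DerivedCategory.Q.map_id _))
  refine IsNoetherianRing.induction_on_isQuotientEquivQuotientPrime R hM
    (motive := fun N _ _ _ => LocalCohomologyVanishes (IsLocalRing.maximalIdeal R) i
      (DerivedCategory.Q.obj (homFrom (ModuleCat.of R N) I))) ?_ ?_ ?_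
  · intro N _ _ _ _
    exact hzero _ (ModuleCat.isZero_of_subsingleton _)
  · intro N _ _ _ p e
    have h0 : LocalCohomologyVanishes (IsLocalRing.maximalIdeal R) i
      (DerivedCategory.Q.obj (homFrom (ModuleCat.of R PUnit.{u + 1}) I)) :=
        hzero _ (ModuleCat.isZero_of_subsingleton _)
    exact hses (shortExact_of_linearMap e.symm.toLinearMap (0 : _ →ₗ[R] PUnit.{u + 1})
      e.symm.injective (Function.surjective_to_subsingleton _)
      ((e.symm.toLinearMap.exact_zero_iff_surjective _).2 e.symm.surjective)) (hcyc p.1) h0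
  · intro N₁ _ _ _ N₂ _ _ _ N₃ _ _ _ f g hf hg hfg h1 h3
    exact hses (shortExact_of_linearMap f g hf hg hfg) h1 h3

end Cohomology

/-! ### Ext modules of finitely generated modules and injective dimension -/

section Bass

variable {I : CochainComplex (ModuleCat.{u} R) ℤ}

theorem finite_of_exact [IsNoetherianRing R] {S : ShortComplex (ModuleCat.{u} R)} (hS : S.Exact)
    (h₁ : Module.Finite R S.X₁) (h₃ : Module.Finite R S.X₃) : Module.Finite R S.X₂ := by
  have : IsNoetherian R S.X₁ := isNoetherian_of_isNoetherianRing_of_finite R _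
  have : IsNoetherian R S.X₃ := isNoetherian_of_isNoetherianRing_of_finite R _
  have : IsNoetherian R S.X₂ :=
    isNoetherian_of_range_eq_ker S.f.hom S.g.hom hS.moduleCat_range_eq_ker
  infer_instance

theorem finite_of_isZero {M : ModuleCat.{u} R} (h : Limits.IsZero M) : Module.Finite R M := by
  have := ModuleCat.subsingleton_of_isZero h
  infer_instance

/-- Evaluation at `1` identifies `Hom_R(R, I)` with `I`. -/
noncomputable def homFromSelfIso (I : CochainComplex (ModuleCat.{u} R) ℤ) :
    homFrom (ModuleCat.of R R) I ≅ I :=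
  HomologicalComplex.Hom.isoOfComponents
    (fun n => LinearEquiv.toModuleIso
      ((ModuleCat.homLinearEquiv (S := R)).trans (LinearMap.ringLmapEquivSelf R R (I.X n)) :
        (ModuleCat.of R R ⟶ I.X n) ≃ₗ[R] I.X n))
    fun _ _ _ => rfl

theorem isZero_homFrom_X (M : ModuleCat.{u} R) {n : ℤ} (h : Limits.IsZero (I.X n)) :
    Limits.IsZero ((homFrom M I).X n) := by
  rw [Limits.IsZero.iff_id_eq_zero]
  refine ModuleCat.hom_ext (LinearMap.ext fun (z : M ⟶ I.X n) => ?_)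
  exact h.eq_of_tgt _ _

theorem isZero_homology_of_isZero_X {K : CochainComplex (ModuleCat.{u} R) ℤ} {n : ℤ}
    (h : Limits.IsZero (K.X n)) : Limits.IsZero (K.homology n) :=
  (HomologicalComplex.exactAt_iff_isZero_homology _ _).1 (.of_isZero h)

theorem homologyMap_smul_id (x : R) (K : CochainComplex (ModuleCat.{u} R) ℤ) (i : ℤ) :
    HomologicalComplex.homologyMap (x • 𝟙 K) i = x • 𝟙 (K.homology i) := by
  rw [← HomologicalComplex.homologyMap_id]
  exact ShortComplex.homologyMap_smul
    ((HomologicalComplex.shortComplexFunctor (ModuleCat.{u} R) (ComplexShape.up ℤ) i).map (𝟙 K)) x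

/-- The modules `Ext^n(M, I)` are finitely generated for finitely generated `M`, by induction on `n`:
`Ext^{n+1}(R ⧸ a, I)` lies between `Ext^n(a, I)` and `H^{n+1}(I)`. -/
theorem finite_homology_homFrom [IsNoetherianRing R] (hI : ∀ n, Injective (I.X n))
    (b : ℤ) (hb : ∀ i < b, Limits.IsZero (I.X i)) (hfg : HomologyFG I) (n : ℤ)
    (M : ModuleCat.{u} R) (hM : Module.Finite R M) :
    Module.Finite R ((homFrom M I).homology n) := by
  have hlow : ∀ n < b, ∀ M : ModuleCat.{u} R, Module.Finite R ((homFrom M I).homology n) :=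
    fun n hn M => finite_of_isZero (isZero_homology_of_isZero_X (isZero_homFrom_X M (hb n hn)))
  rcases lt_or_ge n b with h | h
  · exact hlow n h M
  replace h : b - 1 ≤ n := by lia
  induction n, h using Int.leInduction generalizing M with
  | base => exact hlow _ (by lia) M
  | succ n _ ih =>
    have hses : ∀ {S : ShortComplex (ModuleCat.{u} R)}, S.ShortExact →
        Module.Finite R ((homFrom S.X₁ I).homology (n + 1)) →
        Module.Finite R ((homFrom S.X₃ I).homology (n + 1)) →
        Module.Finite R ((homFrom S.X₂ I).homology (n + 1)) := fun hS h₁ h₃ =>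
      finite_of_exact ((homFromShortComplex_shortExact hS hI).homology_exact₂ (n + 1)) h₃ h₁
    have hzero : ∀ N : ModuleCat.{u} R, Limits.IsZero N →
        Module.Finite R ((homFrom N I).homology (n + 1)) := fun N hN =>
      finite_of_isZero (isZero_homology_of_isZero_X
        ((HomologicalComplex.eval _ _ (n + 1)).map_isZero (isZero_homFrom N hN I)))
    have hcyc : ∀ a : Ideal R,
        Module.Finite R ((homFrom (ModuleCat.of R (R ⧸ a)) I).homology (n + 1)) := by
      intro a
      have hS := shortExact_of_linearMap (Submodule.subtype a) (Submodule.mkQ a)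
        (Submodule.injective_subtype a) (Submodule.mkQ_surjective a)
        (LinearMap.exact_subtype_mkQ a)
      refine finite_of_exact ((homFromShortComplex_shortExact hS hI).homology_exact₁ n (n + 1)
        (by simp)) (ih (ModuleCat.of R a) (inferInstanceAs (Module.Finite R a))) ?_
      have := hfg (n + 1)
      exact Module.Finite.equiv
        (HomologicalComplex.homologyMapIso (homFromSelfIso I) (n + 1)).toLinearEquiv.symm
    refine IsNoetherianRing.induction_on_isQuotientEquivQuotientPrime R hM
      (motive := fun N _ _ _ =>
        Module.Finite R ((homFrom (ModuleCat.of R N) I).homology (n + 1))) ?_ ?_ ?_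
    · intro N _ _ _ _
      exact hzero _ (ModuleCat.isZero_of_subsingleton _)
    · intro N _ _ _ p e
      exact hses (shortExact_of_linearMap e.symm.toLinearMap (0 : _ →ₗ[R] PUnit.{u + 1})
        e.symm.injective (Function.surjective_to_subsingleton _)
        ((e.symm.toLinearMap.exact_zero_iff_surjective _).2 e.symm.surjective)) (hcyc p.1)
        (hzero _ (ModuleCat.isZero_of_subsingleton _))
    · intro N₁ _ _ _ N₂ _ _ _ N₃ _ _ _ f g hf hg hfg h1 h3
      exact hses (shortExact_of_linearMap f g hf hg hfg) h1 h3

/-- If `Ext^i(R ⧸ 𝔪, I) = 0` for all `i > n`, then `Ext^i(R ⧸ a, I) = 0` for all `i > n` and all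
ideals `a`: for a prime `p` and `x ∈ 𝔪 \ p`, vanishing for `R ⧸ (p + (x))` makes `x` surjective on
the finitely generated module `Ext^i(R ⧸ p, I)`, and Nakayama's lemma applies. -/
theorem isZero_homology_homFrom_quotient [IsNoetherianRing R] [IsLocalRing R]
    (hI : ∀ n, Injective (I.X n)) (b : ℤ) (hb : ∀ i < b, Limits.IsZero (I.X i))
    (hfg : HomologyFG I) (n : ℤ)
    (hk : ∀ i > n, Limits.IsZero
      ((homFrom (ModuleCat.of R (R ⧸ IsLocalRing.maximalIdeal R)) I).homology i))
    (a : Ideal R) : ∀ i > n, Limits.IsZero ((homFrom (ModuleCat.of R (R ⧸ a)) I).homology i) := by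
  refine cyclic_induction (P := fun a => ∀ i > n,
    Limits.IsZero ((homFrom (ModuleCat.of R (R ⧸ a)) I).homology i)) ?_ hk ?_ ?_ a
  · intro i _
    have : Subsingleton (R ⧸ (⊤ : Ideal R)) := Ideal.Quotient.subsingleton_iff.2 rfl
    exact isZero_homology_of_isZero_X ((HomologicalComplex.eval _ _ i).map_isZero
      (isZero_homFrom _ (ModuleCat.isZero_of_subsingleton _) I))
  · intro a c x hc h1 h2 i hi
    obtain ⟨e1, e2, e3⟩ := exact_mapQ_factor hc
    exact ((homFromShortComplex_shortExact (shortExact_of_linearMap _ _ e1 e2 e3)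
      hI).homology_exact₂ i).isZero_X₂ ((h2 i hi).eq_of_src _ _) ((h1 i hi).eq_of_tgt _ _)
  · intro p x hp hx hxm h i hi
    obtain ⟨f, w, hS⟩ := exists_shortExact_of_prime hI hp hx
    have hepi := (hS.homology_exact₃ i (i + 1) (by simp)).epi_f
      ((h (i + 1) (by lia)).eq_of_tgt _ _)
    have hmap := homologyMap_smul_id x (homFrom (ModuleCat.of R (R ⧸ p)) I) i
    have hsurj := (ModuleCat.epi_iff_surjective _).1 hepi
    have hfin := finite_homology_homFrom hI b hb hfg i (ModuleCat.of R (R ⧸ p))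
      (inferInstanceAs (Module.Finite R (R ⧸ p)))
    have hbot := Submodule.eq_bot_of_le_smul_of_le_jacobson_bot (IsLocalRing.maximalIdeal R)
      (⊤ : Submodule R ((homFrom (ModuleCat.of R (R ⧸ p)) I).homology i)) hfin.fg_top
      (fun y _ => by
        obtain ⟨z, rfl⟩ := hsurj y
        have : HomologicalComplex.homologyMap
            (x • 𝟙 (homFrom (ModuleCat.of R (R ⧸ p)) I)) i z = x • z :=
          ConcreteCategory.congr_hom hmap z
        exact this ▸ Submodule.smul_mem_smul hxm Submodule.mem_top)
      (IsLocalRing.maximalIdeal_le_jacobson ⊥)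
    have := (Submodule.subsingleton_iff R).1 (subsingleton_of_bot_eq_top hbot.symm)
    exact ModuleCat.isZero_of_subsingleton _

theorem isZero_homology_of_quotient_bot {n : ℤ}
    (h : Limits.IsZero ((homFrom (ModuleCat.of R (R ⧸ (⊥ : Ideal R))) I).homology n)) :
    Limits.IsZero (I.homology n) := by
  rw [isZero_homology_homFrom_iff] at h
  rw [isZero_homology_iff]
  intro z hz
  have h0 : ∀ r ∈ (⊥ : Ideal R), r • z = 0 := fun r hr => by
    rw [(Submodule.mem_bot R).1 hr, zero_smul]
  obtain ⟨w, hw⟩ := h (quotientHom ⊥ z h0) (quotient_hom_ext (by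
    rw [ModuleCat.comp_apply, quotientHom_one, hz]; rfl))
  exact ⟨w (Submodule.mkQ ⊥ (1 : R)),
    (ConcreteCategory.congr_hom hw _).trans (quotientHom_one ⊥ z h0)⟩

/-- Baer's criterion for the cocycles `Z^n`: a map `a ⟶ Z^n` extends to `h : R ⟶ I^n`, and the
cocycle `R ⧸ a ⟶ I^{n+1}` induced by `d ∘ h` is a coboundary, by which `h` may be corrected. -/
theorem injective_cycles {n m : ℤ} (hnm : n + 1 = m) (hI : Injective (I.X n))
    (hE : ∀ a : Ideal R,
      Limits.IsZero ((homFrom (ModuleCat.of R (R ⧸ a)) I).homology m)) :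
    Injective (I.cycles n) := by
  obtain rfl : n = m - 1 := by lia
  refine (Module.injective_iff_injective_object R (I.cycles (m - 1))).1 (Module.Baer.injective ?_)
  intro a g
  let ι : ModuleCat.of R a ⟶ ModuleCat.of R R := ModuleCat.ofHom (Submodule.subtype a)
  have : Mono ι := (ModuleCat.mono_iff_injective _).2 Subtype.val_injective
  let g' : ModuleCat.of R a ⟶ I.X (m - 1) := ModuleCat.ofHom g ≫ I.iCycles (m - 1)
  let h : ModuleCat.of R R ⟶ I.X (m - 1) := Injective.factorThru g' ι
  have hh : ι ≫ h = g' := Injective.comp_factorThru g' ι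
  have hz : ∀ r ∈ a, r • (h ≫ I.d (m - 1) m) (1 : R) = 0 := by
    intro r hr
    have h1 : ι ≫ h ≫ I.d (m - 1) m = 0 := by
      rw [reassoc_of% hh]
      simp [g']
    rw [← map_smul, smul_eq_mul, mul_one]
    exact ConcreteCategory.congr_hom h1 (⟨r, hr⟩ : a)
  have hE' := (isZero_homology_homFrom_iff I m).1 (hE a)
  obtain ⟨w, hw⟩ := hE' (quotientHom a ((h ≫ I.d (m - 1) m) (1 : R)) hz) (quotient_hom_ext (by
    rw [ModuleCat.comp_apply, quotientHom_one]
    exact ConcreteCategory.congr_hom (by simp : (h ≫ I.d (m - 1) m) ≫ I.d m (m + 1) = 0)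
      (1 : R)))
  let π : ModuleCat.of R R ⟶ ModuleCat.of R (R ⧸ a) := ModuleCat.ofHom (Submodule.mkQ a)
  have hπ : π ≫ w ≫ I.d (m - 1) m = h ≫ I.d (m - 1) m := by
    refine ModuleCat.hom_ext (LinearMap.ext_ring ?_)
    exact (ConcreteCategory.congr_hom hw _).trans (quotientHom_one a _ hz)
  let k : ModuleCat.of R R ⟶ I.cycles (m - 1) := I.liftCycles (h - π ≫ w) m (by simp) (by
    rw [Preadditive.sub_comp, Category.assoc, hπ, sub_self])
  refine ⟨k.hom, fun x hx => (ModuleCat.mono_iff_injective (I.iCycles (m - 1))).1 inferInstance ?_⟩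
  have h1 : I.iCycles (m - 1) (k x) = h x - w (π x) :=
    ConcreteCategory.congr_hom (I.liftCycles_i (h - π ≫ w) m (by simp) _) x
  have h2 : π x = 0 := (Submodule.Quotient.mk_eq_zero _).2 hx
  have h3 : h x = I.iCycles (m - 1) (g ⟨x, hx⟩) := ConcreteCategory.congr_hom hh (⟨x, hx⟩ : a)
  rw [h2, map_zero, sub_zero, h3] at h1
  exact h1

theorem isKInjective_of_isInjRes {Y : CochainComplex (ModuleCat.{u} R) ℤ} (h : IsInjRes Y I) :
    I.IsKInjective := by
  obtain ⟨hI, ⟨a, ha⟩, -⟩ := h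
  have : I.IsStrictlyGE a := (I.isStrictlyGE_iff a).2 ha
  exact CochainComplex.isKInjective_of_injective I a

attribute [local instance] HasDerivedCategory.standard in
/-- The truncation `τ^{≤ n} I` of an injective resolution is again an injective resolution when
`H^i(I) = 0` for `i > n` and the module `Z^n` of cocycles is injective. -/
theorem isInjRes_truncLE {Y : CochainComplex (ModuleCat.{u} R) ℤ} (h : IsInjRes Y I) (n : ℤ)
    (hn : ∀ i > n, Limits.IsZero (I.homology i)) (hZ : Injective (I.cycles n)) :
    IsInjRes Y (I.truncLE n) := by
  have hKI := isKInjective_of_isInjRes h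
  obtain ⟨hI, ⟨a, ha⟩, f, hf⟩ := h
  have hLE : I.IsLE n := (I.isLE_iff n).2 fun i hi =>
    (I.exactAt_iff_isZero_homology i).2 (hn i hi)
  have hinj : ∀ i, Injective ((I.truncLE n).X i) := fun i => by
    rcases lt_trichotomy i n with hi | rfl | hi
    · have := hI i
      exact Injective.of_iso (I.truncLEXIso n i hi).symm inferInstance
    · exact Injective.of_iso (I.truncLEXIsoCycles i).symm hZ
    · exact (CochainComplex.isZero_of_isStrictlyLE _ n i hi).injective
  have hlow : ∀ i < min a n, Limits.IsZero ((I.truncLE n).X i) := fun i hi =>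
    (ha i (by lia)).of_iso (I.truncLEXIso n i (by lia))
  have hGE : (I.truncLE n).IsStrictlyGE (min a n) :=
    ((I.truncLE n).isStrictlyGE_iff _).2 hlow
  have := CochainComplex.isKInjective_of_injective (I.truncLE n) (min a n)
  have hι : IsIso (DerivedCategory.Q.map (I.ιTruncLE n)) :=
    (DerivedCategory.isIso_Q_map_iff_quasiIso _ _).2 inferInstance
  obtain ⟨g, hg⟩ := exists_Q_map_eq (inv (DerivedCategory.Q.map (I.ιTruncLE n)))
  have hgq : QuasiIso g := (DerivedCategory.isIso_Q_map_iff_quasiIso _ g).1 (by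
    rw [hg]; infer_instance)
  exact ⟨hinj, ⟨_, hlow⟩, f ≫ g, inferInstance⟩

end Bass

/-! ### Local cohomology, depth and injective dimension -/

section

theorem isTorsionModule_of_isInjRes {a : Ideal R} {W J : CochainComplex (ModuleCat.{u} R) ℤ}
    (h : IsInjRes W J) (hW : ∀ i, IsTorsionModule a (W.homology i)) (i : ℤ) :
    IsTorsionModule a (J.homology i) := by
  obtain ⟨-, -, f, hf⟩ := h
  exact (hW i).of_epi (HomologicalComplex.homologyMap f i)

attribute [local instance] HasDerivedCategory.standard in
theorem localCohomologyVanishes_iff_of_isInjRes (a : Ideal R)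
    {W J : CochainComplex (ModuleCat.{u} R) ℤ} (h : IsInjRes W J) (i : ℤ) :
    LocalCohomologyVanishes a i (DerivedCategory.Q.obj W) ↔
      Limits.IsZero ((sectionComplex a J).homology i) := by
  have := isKInjective_of_isInjRes h
  obtain ⟨-, -, f, hf⟩ := h
  rw [← DerivedCategory.isIso_Q_map_iff_quasiIso] at hf
  rw [← localCohomologyVanishes_iff]
  exact ⟨fun h => h.of_iso (asIso (DerivedCategory.Q.map f)),
    fun h => h.of_iso (asIso (DerivedCategory.Q.map f)).symm⟩

attribute [local instance] HasDerivedCategory.standard in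
theorem isZero_genLocalCohomology_iff (a : Ideal R) {X Y : CochainComplex (ModuleCat.{u} R) ℤ}
    (hX : BddRight X) (hY : BddLeft Y) (i : ℤ) :
    Limits.IsZero (genLocalCohomology a X Y hX hY i) ↔
      LocalCohomologyVanishes a i (DerivedCategory.Q.obj (homComplex X (injRes Y hY))) :=
  (localCohomologyVanishes_iff_of_isInjRes a (injRes_spec (rHom X Y hY) _) i).symm

/-- The local cohomology of a complex whose homology is already torsion is its homology. -/
theorem isZero_genLocalCohomology_iff_of_torsion [IsNoetherianRing R] (a : Ideal R)
    {X Y : CochainComplex (ModuleCat.{u} R) ℤ} (hX : BddRight X) (hY : BddLeft Y)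
    (ht : ∀ i, IsTorsionModule a (ext X Y hY i)) (i : ℤ) :
    Limits.IsZero (genLocalCohomology a X Y hX hY i) ↔ Limits.IsZero (ext X Y hY i) := by
  have hJ := injRes_spec (rHom X Y hY) (rHom_bddLeft hX hY)
  have ht' := isTorsionModule_of_isInjRes hJ ht
  obtain ⟨hinj, ⟨n, hn⟩, f, hf⟩ := hJ
  exact (isZero_homology_sectionComplex_iff _ hinj n hn ht' i).trans
    (asIso (HomologicalComplex.homologyMap f i)).isZero_iff.symm

/-- `Ext^i(M, Y)` is the homology of `Hom_R(M, I)`, with `I` the chosen injective resolution. -/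
noncomputable def extIso (M : ModuleCat.{u} R) (Y : CochainComplex (ModuleCat.{u} R) ℤ)
    (hY : BddLeft Y) (i : ℤ) :
    ext (ofModule M) Y hY i ≅ (homFrom M (injRes Y hY)).homology i :=
  HomologicalComplex.homologyMapIso (homComplexIsoHomFrom M (injRes Y hY)) i

theorem isTorsionModule_ext_quotient (a : Ideal R) (Y : CochainComplex (ModuleCat.{u} R) ℤ)
    (hY : BddLeft Y) (i : ℤ) :
    IsTorsionModule a (ext (ofModule (ModuleCat.of R (R ⧸ a))) Y hY i) := by
  have h : IsTorsionModule a ((homFrom (ModuleCat.of R (R ⧸ a)) (injRes Y hY)).X i) := by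
    rw [IsTorsionModule, eq_top_iff]
    rintro (z : ModuleCat.of R (R ⧸ a) ⟶ (injRes Y hY).X i) -
    refine ⟨1, fun r hr => ?_⟩
    rw [pow_one] at hr
    exact quotient_hom_ext (smul_apply_one z r hr)
  exact ((h.of_mono (HomologicalComplex.iCycles _ i)).of_epi
    (HomologicalComplex.homologyπ _ i)).of_mono (extIso _ Y hY i).hom

attribute [local instance] HasDerivedCategory.standard in
theorem isZero_homology_homFrom_iff_forall_eq_zero (M : ModuleCat.{u} R)
    (I : CochainComplex (ModuleCat.{u} R) ℤ) [I.IsKInjective] (i : ℤ) :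
    Limits.IsZero ((homFrom M I).homology i) ↔
      ∀ f : (DerivedCategory.singleFunctor (ModuleCat.{u} R) i).obj M ⟶ DerivedCategory.Q.obj I,
        f = 0 := by
  rw [isZero_homology_homFrom_iff]
  constructor
  · intro h f
    obtain ⟨z, hz, rfl⟩ := exists_singleHom_eq f
    exact (singleHom_eq_zero_iff z hz).2 (h z hz)
  · intro h z hz
    exact (singleHom_eq_zero_iff z hz).1 (h _)

attribute [local instance] HasDerivedCategory.standard in
/-- Ext may be computed with any injective resolution. -/
theorem isZero_homology_homFrom_of_isInjRes (M : ModuleCat.{u} R)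
    {Y I I' : CochainComplex (ModuleCat.{u} R) ℤ} (h : IsInjRes Y I) (h' : IsInjRes Y I') {i : ℤ}
    (hz : Limits.IsZero ((homFrom M I).homology i)) :
    Limits.IsZero ((homFrom M I').homology i) := by
  have := isKInjective_of_isInjRes h
  have := isKInjective_of_isInjRes h'
  obtain ⟨-, -, f, hf⟩ := h
  obtain ⟨-, -, f', hf'⟩ := h'
  rw [← DerivedCategory.isIso_Q_map_iff_quasiIso] at hf hf'
  rw [isZero_homology_homFrom_iff_forall_eq_zero] at hz ⊢
  intro g
  have := hz (g ≫ inv (DerivedCategory.Q.map f') ≫ DerivedCategory.Q.map f)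
  rw [← cancel_mono (inv (DerivedCategory.Q.map f') ≫ DerivedCategory.Q.map f), this,
    Limits.zero_comp]

theorem isZero_ext_of_injDim_lt (M : ModuleCat.{u} R) {Y : CochainComplex (ModuleCat.{u} R) ℤ}
    (hY : BddLeft Y) {i : ℤ} (h : injDim Y < i) : Limits.IsZero (ext (ofModule M) Y hY i) := by
  obtain ⟨_, ⟨I, hI, rfl⟩, hlt⟩ := sInf_lt_iff.1 h
  have hz : Limits.IsZero (I.X i) := by
    by_contra hcon
    have hmem : (i : EInt) ∈ {t : EInt | ∃ j : ℤ, ¬ Limits.IsZero (I.X j) ∧ t = j} :=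
      ⟨i, hcon, rfl⟩
    exact absurd (le_sSup hmem) (not_le.2 hlt)
  exact (isZero_homology_homFrom_of_isInjRes M hI (injRes_spec Y hY)
    (isZero_homology_of_isZero_X (isZero_homFrom_X M hz))).of_iso (extIso M Y hY i)

theorem isZero_ext_of_lt_depth {a : Ideal R} {Y : CochainComplex (ModuleCat.{u} R) ℤ}
    (hY : BddLeft Y) {i : ℤ} (h : (i : EInt) < depth a Y hY) :
    Limits.IsZero (ext (ofModule (ModuleCat.of R (R ⧸ a))) Y hY i) := by
  by_contra hcon
  have hmem : (i : EInt) ∈ {t : EInt | ∃ j : ℤ,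
      ¬ Limits.IsZero (ext (ofModule (ModuleCat.of R (R ⧸ a))) Y hY j) ∧ t = j} :=
    ⟨i, hcon, rfl⟩
  exact absurd (sInf_le hmem) (not_le.2 h)

theorem homologyFG_injRes {Y : CochainComplex (ModuleCat.{u} R) ℤ} (hY : BddLeft Y)
    (hfg : HomologyFG Y) : HomologyFG (injRes Y hY) := fun i => by
  obtain ⟨-, -, f, hf⟩ := injRes_spec Y hY
  have := hfg i
  exact Module.Finite.equiv (asIso (HomologicalComplex.homologyMap f i)).toLinearEquiv

theorem degZeroFG_ofModule (M : ModuleCat.{u} R)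
    (hM : Module.Finite R M) : DegZeroFG (ofModule M) := by
  have hconc : ∀ i : ℤ, i ≠ 0 → Limits.IsZero ((ofModule M).homology i) := fun i hi =>
    isZero_homology_of_isZero_X (HomologicalComplex.isZero_single_obj_X _ 0 M i hi)
  refine ⟨hconc, fun i => ?_⟩
  by_cases hi : i = 0
  · subst hi
    have : Module.Finite R ((𝟭 (ModuleCat.{u} R)).obj M) := hM
    exact Module.Finite.equiv ((HomologicalComplex.homologyFunctorSingleIso (ModuleCat.{u} R)
      (ComplexShape.up ℤ) 0).app M).toLinearEquiv.symm
  · exact finite_of_isZero (hconc i hi)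

variable [IsNoetherianRing R] [IsLocalRing R]

theorem isZero_ext_quotient {Y : CochainComplex (ModuleCat.{u} R) ℤ} (hY : BddFG Y) {n : ℤ}
    (hk : ∀ i > n, Limits.IsZero
      (ext (ofModule (ModuleCat.of R (R ⧸ IsLocalRing.maximalIdeal R))) Y hY.left i))
    (a : Ideal R) (i : ℤ) (hi : n < i) :
    Limits.IsZero ((homFrom (ModuleCat.of R (R ⧸ a)) (injRes Y hY.left)).homology i) := by
  obtain ⟨hI, ⟨b, hb⟩, -⟩ := injRes_spec Y hY.left
  exact isZero_homology_homFrom_quotient hI b hb (homologyFG_injRes hY.left hY.fg) n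
    (fun i hi => (hk i hi).of_iso (extIso _ Y hY.left i).symm) a i hi

theorem isZero_homology_of_isZero_ext {Y : CochainComplex (ModuleCat.{u} R) ℤ} (hY : BddFG Y)
    {n : ℤ} (hk : ∀ i > n, Limits.IsZero
      (ext (ofModule (ModuleCat.of R (R ⧸ IsLocalRing.maximalIdeal R))) Y hY.left i))
    (i : ℤ) (hi : n < i) : Limits.IsZero (Y.homology i) := by
  obtain ⟨-, -, f, hf⟩ := injRes_spec Y hY.left
  exact (isZero_homology_of_quotient_bot (isZero_ext_quotient hY hk ⊥ i hi)).of_iso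
    (asIso (HomologicalComplex.homologyMap f i))

/-- The injective dimension of `Y` is bounded by the degrees `i` with `Ext^i(k, Y) ≠ 0`. -/
theorem injDim_le {Y : CochainComplex (ModuleCat.{u} R) ℤ} (hY : BddFG Y) {n : ℤ}
    (hk : ∀ i > n, Limits.IsZero
      (ext (ofModule (ModuleCat.of R (R ⧸ IsLocalRing.maximalIdeal R))) Y hY.left i)) :
    injDim Y ≤ n := by
  have hI := injRes_spec Y hY.left
  have hE := isZero_ext_quotient hY hk
  have hres := isInjRes_truncLE hI n
    (fun i hi => isZero_homology_of_quotient_bot (hE ⊥ i hi))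
    (injective_cycles rfl (hI.injective n) fun a => hE a (n + 1) (by lia))
  have hmem : sSup {t : EInt | ∃ i : ℤ,
      ¬ Limits.IsZero (((injRes Y hY.left).truncLE n).X i) ∧ t = i} ∈
      {s : EInt | ∃ I, IsInjRes Y I ∧
        s = sSup {t : EInt | ∃ i : ℤ, ¬ Limits.IsZero (I.X i) ∧ t = i}} := ⟨_, hres, rfl⟩
  refine (sInf_le hmem).trans (sSup_le ?_)
  rintro _ ⟨i, hi, rfl⟩
  refine WithBotTop.coe_le_coe.2 (not_lt.1 fun hlt => hi ?_)
  exact CochainComplex.isZero_of_isStrictlyLE _ n i hlt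

/-- A complex is Gorenstein if and only if its only nonzero Ext module from the residue field is the
one in degree `depth Y`. -/
theorem injDim_eq_localDepth_iff {Y : CochainComplex (ModuleCat.{u} R) ℤ} (hY : BddFG Y)
    (hY0 : ¬ HomologicallyTrivial Y) :
    injDim Y = localDepth Y hY.left ↔ ∀ i : ℤ, (i : EInt) ≠ localDepth Y hY.left →
      Limits.IsZero
        (ext (ofModule (ModuleCat.of R (R ⧸ IsLocalRing.maximalIdeal R))) Y hY.left i) := by
  constructor
  · intro h i hi
    rcases lt_or_gt_of_ne hi with hlt | hgt
    · exact isZero_ext_of_lt_depth hY.left hlt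
    · exact isZero_ext_of_injDim_lt _ hY.left (h ▸ hgt)
  · intro h
    -- if all Ext modules vanish, then so does the homology of `Y`
    obtain ⟨j, hj⟩ : ∃ j : ℤ, ¬ Limits.IsZero
        (ext (ofModule (ModuleCat.of R (R ⧸ IsLocalRing.maximalIdeal R))) Y hY.left j) := by
      by_contra! hcon
      exact hY0 fun i => isZero_homology_of_isZero_ext (n := i - 1) hY (fun j _ => hcon j) i
        (by lia)
    have hd : (j : EInt) = localDepth Y hY.left := by
      by_contra hcon
      exact hj (h j hcon)
    rw [← hd] at h ⊢
    refine le_antisymm (injDim_le hY fun i hi => h i ?_) (not_lt.1 fun hlt => hj ?_)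
    · exact fun heq => hi.ne' (WithBotTop.coe_injective heq)
    · exact isZero_ext_of_injDim_lt _ hY.left hlt

attribute [local instance] HasDerivedCategory.standard in
/-- If the local cohomology `H^i_𝔪(k, Y)` vanishes, then so does `H^i_𝔪(X, Y)` for all complexes `X`
with finitely generated homology concentrated in degree `0`. -/
theorem isZero_genLocalCohomology_of_residueField
    {X Y : CochainComplex (ModuleCat.{u} R) ℤ} (hX : DegZeroFG X) (hY : BddLeft Y) {i : ℤ}
    (hR : BddRight (ofModule (ModuleCat.of R (R ⧸ IsLocalRing.maximalIdeal R))))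
    (hk : Limits.IsZero (genLocalCohomology (IsLocalRing.maximalIdeal R)
      (ofModule (ModuleCat.of R (R ⧸ IsLocalRing.maximalIdeal R))) Y hR hY i)) :
    Limits.IsZero (genLocalCohomology (IsLocalRing.maximalIdeal R) X Y hX.right hY i) := by
  have hI := injRes_spec Y hY
  have := isKInjective_of_isInjRes hI
  rw [isZero_genLocalCohomology_iff] at hk ⊢
  obtain ⟨M, hM, e⟩ := exists_iso_Q_homFrom hX
  refine (localCohomologyVanishes_homFrom hI.injective i (hk.of_iso ?_) M hM).of_iso
    (e (injRes Y hY)).some.symm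
  exact DerivedCategory.Q.mapIso (homComplexIsoHomFrom _ _)

end

end GorCx

theorem proposition4p4 {R : Type*} [CommRing R] [IsNoetherianRing R] [IsLocalRing R]
    (Y : CochainComplex (ModuleCat R) ℤ) (hY : GorCx.BddFG Y)
    (hY0 : ¬ GorCx.HomologicallyTrivial Y) :
    [GorCx.IsGorenstein Y,
      GorCx.perp Y hY.left = {X | GorCx.DegZeroFG X},
      GorCx.ofModule (ModuleCat.of R (IsLocalRing.ResidueField R)) ∈ GorCx.perp Y hY.left].TFAE := by
  have hk : GorCx.DegZeroFG (GorCx.ofModule (ModuleCat.of R (IsLocalRing.ResidueField R))) :=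
    GorCx.degZeroFG_ofModule _
      (inferInstanceAs (Module.Finite R (R ⧸ IsLocalRing.maximalIdeal R)))
  have hgor : GorCx.IsGorenstein Y ↔ GorCx.injDim Y = GorCx.localDepth Y hY.left :=
    ⟨fun ⟨_, _, h⟩ => h, fun h => ⟨hY, hY0, h⟩⟩
  -- the Ext modules of the residue field are torsion, so they agree with its local cohomology
  have hext := GorCx.isZero_genLocalCohomology_iff_of_torsion (IsLocalRing.maximalIdeal R)
    hk.right hY.left (GorCx.isTorsionModule_ext_quotient _ Y hY.left)
  tfae_have 1 ↔ 3 := by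
    rw [hgor, GorCx.injDim_eq_localDepth_iff hY hY0]
    exact ⟨fun h => ⟨hk, fun i hi => (hext i).2 (h i hi)⟩,
      fun ⟨_, h⟩ i hi => (hext i).1 (h i hi)⟩
  tfae_have 2 → 3 := fun h => h ▸ hk
  tfae_have 3 → 2 := by
    rintro ⟨_, h⟩
    refine Set.Subset.antisymm (fun X ⟨hX, _⟩ => hX) fun X hX => ⟨hX, fun i hi => ?_⟩
    exact GorCx.isZero_genLocalCohomology_of_residueField hX hY.left hk.right (h i hi)
  tfae_finish
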